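/- Let $X$ be a geodesic metric space that is hyperbolic in the sense of Gromov, with Gromov boundary $\partial X$, and let a group $\Gamma$ act on $X$ by isometries; $\Gamma$ then also acts on $\partial X$, on $(\partial X\times\partial X)\setminus\Delta$ (with $\Delta$ the diagonal), and on the space $\partial^2X$ of two-point subsets of $\partial X$, which carries the quotient topology of $(\partial X\times\partial X)\setminus\Delta$. An element $h\in\Gamma$ is \emph{loxodromic} if $k\mapsto h^k\cdot x$ is a quasi-isometric embedding $\mathbb Z\to X$ for some (equivalently every) $x\in X$; then $\partial_+h=\lim_{k\to+\infty}h^k x$ and $\partial_-h=\lim_{k\to-\infty}h^kx$ are distinct points of $\partial X$, and we write $\partial_\pm h=(\partial_-h,\partial_+h)$ and $\partial h=\{\partial_-h,\partial_+h\}$. Loxodromic elements $g,h$ are \emph{independent} if $\partial g\cap\partial h=\emptyset$. A \emph{quasi-axis} of $h$ is a continuous quasi-isometric embedding $\ell:\mathbb R\to X$ such that, for some $T>0$, $h\cdot\ell(t)=\ell(t+T)$ for all $t\in\mathbb R$; we also write $\ell$ for its image. $\mathrm{Stab}$ denotes stabilizers in $\Gamma$; thus $\mathrm{Stab}(\partial_\pm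 h)$ fixes both $\partial_-h$ and $\partial_+h$, while $\mathrm{Stab}(\partial h)$ preserves the set $\partial h$. Let $h\in\Gamma$ be loxodromic. The following are equivalent. \begin{enumerate} \item[(1)] For every $x\in X$ and $R>0$ there is an integer $M\ge1$ such that every subset $Z\subset\Gamma$ with the following two properties is finite: $d(x,gx)<R$ and $d(h^Mx,gh^Mx)<R$ for each $g\in Z$; and no two distinct elements of $Z$ lie in the same left coset of $\mathrm{Stab}(\partial_\pm h)$. \item[(2)] The $\Gamma$-orbit of $\partial h$ is a discrete subset of $\partial^2X$. \item[(2$'$)] The $\Gamma$-orbit of $\partial_\pm h$ is a discrete subset of $(\partial X\times\partial X)\setminus\Delta$. \item[(3)] For every quasi-axis $\ell$ of $h$ there is $D\ge0$ such that for every $g\in\Gamma\setminus\mathrm{Stab}(\partial h)$ the image of every closest point map $g(\ell)\to\ell$ has diameter at most $D$. \item[(4$_\forall$)] There is no infinite sequence $g_1,g_2,\dots$ in $\Gamma$, with $g_i,g_j$ in different left cosets of $\mathrm{Stab}(\partial_\pm h)$ whenever $i\ne j$, such that for every $x\in X$ there is $R>0$ such that for all $M\ge0$ there is $I\ge0$ with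 $d(g_ih^mx,h^mx)<R$ whenever $0\le m\le M$ and $i\ge I$. \item[(4$_\exists$)] The same as (4$_\forall$), with ``for every $x\in X$'' replaced by ``for some $x\in X$''. \end{enumerate} A loxodromic element $h$ with these properties is called \emph{WWPD}. If $h$ is WWPD, then moreover: \begin{enumerate} \item[(5)] $\mathrm{Stab}(\partial_-h)=\mathrm{Stab}(\partial_+h)=\mathrm{Stab}(\partial_\pm h)$, and for every loxodromic $\gamma\in\Gamma$ the set $\partial\gamma$ is either equal to or disjoint from $\partial h$. \item[(6)] If $k\in\Gamma\setminus\mathrm{Stab}(\partial h)$, then $h$ and $khk^{-1}$ are independent loxodromic elements. \end{enumerate} -/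

import Mathlib

open Filter Topology

namespace HyperbolicAction

/-! ### Hyperbolic spaces -/

section Space

variable {X : Type*} [MetricSpace X]

/-- The Gromov product `(x | y)_p`. -/
noncomputable def gromovProduct (p x y : X) : ℝ := (dist p x + dist p y - dist x y) / 2

variable (X) in
/-- Hyperbolicity in the sense of Gromov. -/
class IsGromovHyperbolic : Prop where
  exists_delta : ∃ δ : ℝ, 0 ≤ δ ∧ ∀ p x y z : X,
    min (gromovProduct p x y) (gromovProduct p y z) - δ ≤ gromovProduct p x z

variable (X) in
/-- A geodesic metric space: any two points are joined by a path whose restriction to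
`[0, d(x,y)]` is an isometric embedding. -/
def IsGeodesicSpace : Prop :=
  ∀ x y : X, ∃ c : ℝ → X, c 0 = x ∧ c (dist x y) = y ∧
    ∀ s ∈ Set.Icc 0 (dist x y), ∀ t ∈ Set.Icc 0 (dist x y), dist (c s) (c t) = |s - t|

/-- Quasi-isometric embeddings. -/
def IsQuasiIsometricEmbedding {Y Z : Type*} [MetricSpace Y] [MetricSpace Z] (f : Y → Z) : Prop :=
  ∃ K c : ℝ, 1 ≤ K ∧ 0 ≤ c ∧ ∀ s t : Y,
    dist s t / K - c ≤ dist (f s) (f t) ∧ dist (f s) (f t) ≤ K * dist s t + c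

theorem gromovProduct_comm (p x y : X) : gromovProduct p x y = gromovProduct p y x := by
  unfold gromovProduct; rw [dist_comm x y]; ring

theorem gromovProduct_nonneg (p x y : X) : 0 ≤ gromovProduct p x y := by
  unfold gromovProduct
  have := dist_triangle_left x y p
  linarith

theorem gromovProduct_le_left (p x y : X) : gromovProduct p x y ≤ dist p x := by
  unfold gromovProduct
  have := dist_triangle p x y
  linarith

/-! ### The Gromov boundary -/

/-- `(x_i | y_j)_p → ∞` as `i, j → ∞`, for every base point `p`. -/
def SeqAsymptotic (x y : ℕ → X) : Prop :=
  ∀ p : X, Tendsto (fun n : ℕ × ℕ => gromovProduct p (x n.1) (y n.2)) atTop atTop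

theorem SeqAsymptotic.symm {x y : ℕ → X} (h : SeqAsymptotic x y) : SeqAsymptotic y x := by
  intro p
  have hs : Tendsto (fun n : ℕ × ℕ => (n.2, n.1)) atTop atTop := by
    rw [← prod_atTop_atTop_eq]
    exact tendsto_snd.prodMk tendsto_fst
  refine ((h p).comp hs).congr fun n => ?_
  exact gromovProduct_comm _ _ _

theorem SeqAsymptotic.trans [IsGromovHyperbolic X] {x y z : ℕ → X} (h : SeqAsymptotic x y)
    (h' : SeqAsymptotic y z) : SeqAsymptotic x z := by
  intro p
  obtain ⟨δ, -, hδ⟩ := IsGromovHyperbolic.exists_delta (X := X)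
  have hs : Tendsto (fun n : ℕ × ℕ => (n.1, n.1)) atTop atTop := by
    rw [← prod_atTop_atTop_eq]
    exact tendsto_fst.prodMk tendsto_fst
  rw [tendsto_atTop]
  intro b
  filter_upwards [((h p).comp hs).eventually_ge_atTop (b + δ), (h' p).eventually_ge_atTop (b + δ)]
    with n h1 h2
  have h3 := hδ p (x n.1) (y n.1) (z n.2)
  have h4 := le_min h1 h2
  simp only [Function.comp] at h4
  linarith

/-- It suffices to check a single base point. -/
theorem seqAsymptotic_of_basepoint {x y : ℕ → X} (q : X)
    (h : Tendsto (fun n : ℕ × ℕ => gromovProduct q (x n.1) (y n.2)) atTop atTop) :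
    SeqAsymptotic x y := by
  intro p
  rw [tendsto_atTop]
  intro b
  filter_upwards [h.eventually_ge_atTop (b + dist p q)] with n hn
  unfold gromovProduct at *
  have h1 := dist_triangle_left q (x n.1) p
  have h2 := dist_triangle_left q (y n.2) p
  have h3 := dist_triangle q p (x n.1)
  have h4 := dist_triangle q p (y n.2)
  rw [dist_comm q p] at h3 h4
  linarith

variable (X) in
/-- Sequences that converge at infinity. -/
abbrev GromovSeq : Type _ := {x : ℕ → X // SeqAsymptotic x x}

variable (X) in
instance gromovSeqSetoid [IsGromovHyperbolic X] : Setoid (GromovSeq X) where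
  r x y := SeqAsymptotic x.1 y.1
  iseqv := ⟨fun x => x.2, fun h => h.symm, fun h h' => h.trans h'⟩

variable (X) in
/-- The Gromov boundary `∂X`. -/
def GromovBoundary [IsGromovHyperbolic X] : Type _ := Quotient (gromovSeqSetoid X)

variable [IsGromovHyperbolic X]

/-- The basic neighbourhood of `ξ` in `∂X` of those `η` with `(ξ | η)_p ≥ r`. -/
def boundaryNhd (p : X) (ξ : GromovBoundary X) (r : ℝ) : Set (GromovBoundary X) :=
  {η | ∃ x y : GromovSeq X, (⟦x⟧ : Quotient (gromovSeqSetoid X)) = ξ ∧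
    (⟦y⟧ : Quotient (gromovSeqSetoid X)) = η ∧
    ∀ᶠ n : ℕ × ℕ in atTop, r ≤ gromovProduct p (x.1 n.1) (y.1 n.2)}

theorem boundaryNhd_anti (p : X) (ξ : GromovBoundary X) {r s : ℝ} (hrs : r ≤ s) :
    boundaryNhd p ξ s ⊆ boundaryNhd p ξ r := by
  rintro η ⟨x, y, hx, hy, h⟩
  exact ⟨x, y, hx, hy, h.mono fun n hn => hrs.trans hn⟩

/-- The topology of `∂X`: a set is open when it contains a basic neighbourhood of each
of its points. -/
instance : TopologicalSpace (GromovBoundary X) where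
  IsOpen U := ∀ ξ ∈ U, ∀ p : X, ∃ r : ℝ, boundaryNhd p ξ r ⊆ U
  isOpen_univ := fun _ _ _ => ⟨0, Set.subset_univ _⟩
  isOpen_inter := by
    intro U V hU hV ξ hξ p
    obtain ⟨r, hr⟩ := hU ξ hξ.1 p
    obtain ⟨s, hs⟩ := hV ξ hξ.2 p
    exact ⟨max r s, Set.subset_inter ((boundaryNhd_anti p ξ (le_max_left r s)).trans hr)
      ((boundaryNhd_anti p ξ (le_max_right r s)).trans hs)⟩
  isOpen_sUnion := by
    intro S hS ξ hξ p
    obtain ⟨U, hU, hξU⟩ := hξ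
    obtain ⟨r, hr⟩ := hS U hU ξ hξU p
    exact ⟨r, hr.trans (Set.subset_sUnion_of_mem hU)⟩

variable (X) in
/-- The space `∂X × ∂X - Δ` of ordered pairs of distinct boundary points. -/
abbrev BoundaryPair : Type _ := {q : GromovBoundary X × GromovBoundary X // q.1 ≠ q.2}

variable (X) in
/-- The space `∂²X` of two point subsets of the boundary. -/
def BoundaryTwoSet : Type _ := {S : Set (GromovBoundary X) // S.ncard = 2}

/-- The two-to-one map `(ξ, η) ↦ {ξ, η}`. -/
def BoundaryPair.toTwoSet (q : BoundaryPair X) : BoundaryTwoSet X :=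
  ⟨{q.1.1, q.1.2}, Set.ncard_pair q.2⟩

/-- `∂²X` carries the quotient topology. -/
instance : TopologicalSpace (BoundaryTwoSet X) :=
  TopologicalSpace.coinduced BoundaryPair.toTwoSet inferInstance

end Space

/-! ### Hyperbolic actions -/

section Action

open scoped Pointwise

variable {Γ : Type*} [Group Γ] {X : Type*} [MetricSpace X] [MulAction Γ X]
  [IsIsometricSMul Γ X]

theorem gromovProduct_smul (g : Γ) (p x y : X) :
    gromovProduct (g • p) (g • x) (g • y) = gromovProduct p x y := by
  simp [gromovProduct, dist_smul]

theorem SeqAsymptotic.smul (g : Γ) {x y : ℕ → X} (h : SeqAsymptotic x y) :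
    SeqAsymptotic (fun n => g • x n) (fun n => g • y n) := by
  intro p
  refine (h (g⁻¹ • p)).congr fun n => ?_
  rw [← gromovProduct_smul g, smul_inv_smul]

section Boundary

variable [IsGromovHyperbolic X]

/-- The action on `∂X` that extends the action on `X`. -/
instance : MulAction Γ (GromovBoundary X) where
  smul g := Quotient.map (fun x : GromovSeq X => ⟨fun n => g • x.1 n, x.2.smul g⟩)
    fun _ _ h => SeqAsymptotic.smul g h
  one_smul := by
    rintro ⟨x⟩
    refine Quotient.sound ?_
    change SeqAsymptotic (fun n => (1 : Γ) • x.1 n) x.1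
    simpa only [one_smul] using x.2
  mul_smul := by
    rintro g k ⟨x⟩
    refine Quotient.sound ?_
    change SeqAsymptotic (fun n => (g * k) • x.1 n) (fun n => g • k • x.1 n)
    simpa only [mul_smul] using (x.2.smul k).smul g

/-- The diagonal action on `∂X × ∂X - Δ`. -/
instance : MulAction Γ (BoundaryPair X) where
  smul g q := ⟨(g • q.1.1, g • q.1.2), fun h => q.2 (MulAction.injective g h)⟩
  one_smul q := Subtype.ext (one_smul Γ q.1)
  mul_smul g k q := Subtype.ext (mul_smul g k q.1)

/-- The induced action on `∂²X`. -/
instance : MulAction Γ (BoundaryTwoSet X) where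
  smul g S := ⟨g • S.1, by
    rw [← Set.image_smul, Set.ncard_image_of_injective _ (MulAction.injective g)]
    exact S.2⟩
  one_smul S := Subtype.ext (one_smul Γ S.1)
  mul_smul g k S := Subtype.ext (mul_smul g k S.1)

end Boundary

/-! ### Loxodromic elements and their end points -/

variable (X) in
/-- `h` is loxodromic: `k ↦ h ^ k • x` is a quasi-isometric embedding of `ℤ` for some `x`. -/
def IsLoxodromic (h : Γ) : Prop :=
  ∃ x : X, IsQuasiIsometricEmbedding fun k : ℤ => h ^ k • x

theorem IsLoxodromic.inv {h : Γ} (hh : IsLoxodromic X h) : IsLoxodromic X h⁻¹ := by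
  obtain ⟨x, K, c, hK, hc, H⟩ := hh
  refine ⟨x, K, c, hK, hc, fun s t => ?_⟩
  have := H (-s) (-t)
  simpa only [inv_zpow', dist_neg_neg] using this

theorem dist_pow_smul_pow_smul (h : Γ) (x : X) (m d : ℕ) :
    dist (h ^ m • x) (h ^ (m + d) • x) = dist x (h ^ d • x) := by
  rw [pow_add, mul_smul, dist_smul]

/-- For every base point the displacement of `h ^ n` grows at least linearly. -/
theorem IsLoxodromic.linear_growth {h : Γ} (hh : IsLoxodromic X h) (x : X) :
    ∃ K c : ℝ, 1 ≤ K ∧ 0 ≤ c ∧ ∀ n : ℕ, n / K - c ≤ dist x (h ^ n • x) := by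
  obtain ⟨y, K, c, hK, hc, H⟩ := hh
  refine ⟨K, c + 2 * dist x y, hK, by positivity, fun n => ?_⟩
  have h1 := (H 0 n).1
  simp only [zpow_zero, one_smul, zpow_natCast] at h1
  have h0 : dist (0 : ℤ) (n : ℤ) = n := by
    rw [dist_comm, Int.dist_eq]; simp
  rw [h0] at h1
  have h2 := dist_triangle4 y x (h ^ n • x) (h ^ n • y)
  rw [dist_smul, dist_comm y x] at h2
  linarith

theorem exists_log_bound (K δ : ℝ) (hK : 1 ≤ K) (hδ : 0 ≤ δ) :
    ∃ C : ℝ, 0 ≤ C ∧ ∀ n : ℕ, ∃ k : ℕ, n ≤ 2 ^ k ∧ k * δ ≤ n / (2 * K) + C := by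
  have hsq : ∀ l : ℕ, l ^ 2 ≤ 4 * 2 ^ l := by
    intro l
    induction l with
    | zero => simp
    | succ l ih =>
      rcases Nat.lt_or_ge l 3 with hl | hl
      · interval_cases l <;> norm_num
      · rw [pow_succ 2 l]
        nlinarith
  refine ⟨δ + 2 * K * δ ^ 2, by positivity, fun n => ?_⟩
  rcases Nat.eq_zero_or_pos n with rfl | hn
  · exact ⟨0, by simp, by simp; positivity⟩
  refine ⟨Nat.log 2 n + 1, (Nat.lt_pow_succ_log_self (by norm_num) n).le, ?_⟩
  set l := Nat.log 2 n
  have h1 : 2 ^ l ≤ n := Nat.pow_log_le_self 2 hn.ne'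
  have h2 : (l : ℝ) ^ 2 ≤ 4 * n := by exact_mod_cast (hsq l).trans (by omega)
  have hK0 : 0 < K := by linarith
  have h3 : (l : ℝ) * δ ≤ n / (2 * K) + 2 * K * δ ^ 2 := by
    rw [div_add' _ _ _ (by positivity), le_div_iff₀ (by positivity)]
    nlinarith [sq_nonneg ((l : ℝ) - 4 * K * δ)]
  push_cast
  linarith

theorem IsLoxodromic.exists_gromovProduct_ge [IsGromovHyperbolic X] {h : Γ}
    (hh : IsLoxodromic X h) (x : X) : ∃ K C : ℝ, 1 ≤ K ∧ ∀ n m : ℕ, n ≤ m →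
      n / (2 * K) - C ≤ gromovProduct x (h ^ n • x) (h ^ m • x) := by
  obtain ⟨δ, hδ0, hδ⟩ := IsGromovHyperbolic.exists_delta (X := X)
  obtain ⟨K, c, hK, hc, H⟩ := hh.linear_growth x
  obtain ⟨C, hC, hlog⟩ := exists_log_bound K δ hK hδ0
  have hK0 : 0 < K := by linarith
  set a : ℝ := dist x (h ^ 1 • x) with ha
  have ha0 : 0 ≤ a := dist_nonneg
  have step2 : ∀ k j d : ℕ, d ≤ 2 ^ k → j / K - (c + a) - k * δ ≤
      gromovProduct x (h ^ j • x) (h ^ (j + d) • x) := by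
    intro k
    induction k with
    | zero =>
      intro j d hd
      have h1 := H j
      have h2 := dist_pow_smul_pow_smul h x j d
      have h3 : dist x (h ^ d • x) ≤ a := by
        have : d = 0 ∨ d = 1 := by simp at hd; omega
        rcases this with rfl | rfl
        · simpa using ha0
        · exact le_rfl
      have h4 := dist_triangle x (h ^ (j + d) • x) (h ^ j • x)
      rw [dist_comm (h ^ (j + d) • x)] at h4
      unfold gromovProduct
      push_cast
      linarith
    | succ k ih =>
      intro j d hd
      rcases le_total d (2 ^ k) with hdk | hdk
      · have := ih j d hdk
        push_cast
        nlinarith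
      · obtain ⟨e, rfl⟩ := Nat.exists_eq_add_of_le hdk
        have h1 := ih j (2 ^ k) le_rfl
        have h2 := ih (j + 2 ^ k) e (by rw [pow_succ] at hd; omega)
        have h3 := hδ x (h ^ j • x) (h ^ (j + 2 ^ k) • x) (h ^ (j + 2 ^ k + e) • x)
        have h4 : (j : ℝ) / K ≤ ((j + 2 ^ k : ℕ) : ℝ) / K := by
          gcongr; exact Nat.le_add_right _ _
        have h5 := le_min h1 (le_trans (by linarith) h2)
        rw [← add_assoc]
        push_cast
        linarith
  have step3 : ∀ n m : ℕ, n ≤ m → m ≤ 2 * n → n / (2 * K) - (c + a) - C ≤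
      gromovProduct x (h ^ n • x) (h ^ m • x) := by
    intro n m hnm hm
    obtain ⟨k, hk, hkC⟩ := hlog n
    obtain ⟨d, rfl⟩ := Nat.exists_eq_add_of_le hnm
    have h1 := step2 k n d (by omega)
    have h2 : (n : ℝ) / K = n / (2 * K) + n / (2 * K) := by field_simp; norm_num
    linarith
  refine ⟨K, c + a + C + δ, hK, ?_⟩
  have key : ∀ N n m : ℕ, m - n ≤ N → n ≤ m → n / (2 * K) - (c + a + C + δ) ≤
      gromovProduct x (h ^ n • x) (h ^ m • x) := by
    intro N
    induction N with
    | zero =>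
      intro n m h1 h2
      have := step3 n m h2 (by omega)
      linarith
    | succ N ih =>
      intro n m h1 h2
      rcases le_or_gt m (2 * n) with hm | hm
      · have := step3 n m h2 hm
        linarith
      · rcases le_or_gt δ ((n : ℝ) / (2 * K)) with hn | hn
        · have hn0 : n ≠ 0 ∨ δ ≤ 0 := by
            rcases eq_or_ne n 0 with rfl | h0
            · right; simpa using hn
            · left; exact h0
          rcases eq_or_ne n 0 with rfl | h0
          · have := gromovProduct_nonneg x (h ^ 0 • x) (h ^ m • x)
            push_cast
            simp only [zero_div]
            linarith
          · have h3 := step3 n (2 * n) (by omega) le_rfl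
            have h4 := ih (2 * n) m (by omega) (by omega)
            have h5 := hδ x (h ^ n • x) (h ^ (2 * n) • x) (h ^ m • x)
            have h6 : ((2 * n : ℕ) : ℝ) / (2 * K) = n / (2 * K) + n / (2 * K) := by
              push_cast; field_simp; norm_num
            have h7 : (n : ℝ) / (2 * K) - (c + a) - C ≤
                min (gromovProduct x (h ^ n • x) (h ^ (2 * n) • x))
                  (gromovProduct x (h ^ (2 * n) • x) (h ^ m • x)) :=
              le_min h3 (le_trans (by linarith) h4)
            linarith
        · have := gromovProduct_nonneg x (h ^ n • x) (h ^ m • x)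
          linarith
  exact fun n m hnm => key (m - n) n m le_rfl hnm

/-- Forward orbits of a loxodromic element converge at infinity. -/
theorem IsLoxodromic.seqAsymptotic [IsGromovHyperbolic X] {h : Γ} (hh : IsLoxodromic X h)
    (x : X) : SeqAsymptotic (fun n => h ^ n • x) (fun n => h ^ n • x) := by
  obtain ⟨K, C, hK, H⟩ := hh.exists_gromovProduct_ge x
  have hK0 : 0 < K := by linarith
  refine seqAsymptotic_of_basepoint x ?_
  rw [tendsto_atTop]
  intro b
  obtain ⟨N, hN⟩ := exists_nat_ge ((b + C) * (2 * K))
  filter_upwards [eventually_ge_atTop (N, N)] with n hn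
  have main : ∀ i j : ℕ, N ≤ i → i ≤ j → b ≤ gromovProduct x (h ^ i • x) (h ^ j • x) := by
    intro i j hi hij
    have h1 := H i j hij
    have h2 : b + C ≤ (i : ℝ) / (2 * K) := by
      rw [le_div_iff₀ (by positivity)]
      exact hN.trans (by exact_mod_cast hi)
    linarith
  rcases le_total n.1 n.2 with h1 | h1
  · exact main _ _ hn.1 h1
  · rw [gromovProduct_comm]
    exact main _ _ hn.2 h1

section EndPoints

variable [IsGromovHyperbolic X]

/-- The limit in `∂X` of the sequence `h ^ n • x`, which does not depend on `x`. -/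
noncomputable def attractingPoint (h : Γ) (hh : IsLoxodromic X h) : GromovBoundary X :=
  (⟦⟨fun n => h ^ n • hh.choose, hh.seqAsymptotic _⟩⟧ : Quotient (gromovSeqSetoid X))

theorem attractingPoint_eq (h : Γ) (hh : IsLoxodromic X h) (x : X) :
    attractingPoint h hh =
      (⟦⟨fun n => h ^ n • x, hh.seqAsymptotic x⟩⟧ : Quotient (gromovSeqSetoid X)) := by
  refine Quotient.sound ?_
  change SeqAsymptotic (fun n => h ^ n • hh.choose) (fun n => h ^ n • x)
  intro p
  rw [tendsto_atTop]
  intro b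
  filter_upwards [(hh.seqAsymptotic x p).eventually_ge_atTop (b + dist hh.choose x)] with n hn
  unfold gromovProduct at *
  have h1 := dist_triangle p (h ^ n.1 • hh.choose) (h ^ n.1 • x)
  have h2 := dist_triangle (h ^ n.1 • hh.choose) (h ^ n.1 • x) (h ^ n.2 • x)
  rw [dist_smul] at h1 h2
  linarith

/-- The limit in `∂X` of the sequence `h ^ (-n) • x`. -/
noncomputable def repellingPoint (h : Γ) (hh : IsLoxodromic X h) : GromovBoundary X :=
  attractingPoint h⁻¹ hh.inv

theorem repellingPoint_ne_attractingPoint (h : Γ) (hh : IsLoxodromic X h) :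
    repellingPoint h hh ≠ attractingPoint h hh := by
  obtain ⟨x, -⟩ := id hh
  rw [repellingPoint, attractingPoint_eq _ _ x, attractingPoint_eq _ _ x]
  intro heq
  have has : SeqAsymptotic (fun n => h⁻¹ ^ n • x) (fun n => h ^ n • x) := Quotient.exact heq
  obtain ⟨δ, hδ0, hδ⟩ := IsGromovHyperbolic.exists_delta (X := X)
  obtain ⟨K, c, hK, hc, H⟩ := hh.linear_growth x
  have hK0 : 0 < K := by linarith
  obtain ⟨n, hn⟩ := exists_nat_ge (K * (δ + 1))
  obtain ⟨⟨N1, N2⟩, hN⟩ :=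
    eventually_atTop.1 ((has x).eventually_ge_atTop (dist x (h ^ n • x)))
  set A : ℕ → ℝ := fun m => dist x (h ^ m • x) with hA
  have step : ∀ M, N1 ≤ M → N2 ≤ M → n ≤ M → A (M + n) ≤ A (M - n) + 2 * δ := by
    intro M h1 h2 h3
    have hB : A n ≤ gromovProduct x (h⁻¹ ^ M • x) (h ^ M • x) := hN (M, M) ⟨h1, h2⟩
    have hg := hδ x (h ^ n • x) (h ^ M • x) (h⁻¹ ^ M • x)
    have hg' := gromovProduct_le_left x (h ^ n • x) (h ^ M • x)
    rw [gromovProduct_comm x (h ^ M • x), min_eq_left (hg'.trans hB)] at hg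
    have e1 : dist x (h⁻¹ ^ M • x) = A M := by
      rw [hA, inv_pow, ← dist_smul (h ^ M), smul_inv_smul, dist_comm]
    have e2 : dist (h ^ n • x) (h⁻¹ ^ M • x) = A (M + n) := by
      rw [hA, inv_pow, ← dist_smul (h ^ M), smul_inv_smul, ← mul_smul, ← pow_add, dist_comm]
    have e3 : dist (h ^ n • x) (h ^ M • x) = A (M - n) := by
      obtain ⟨d, rfl⟩ := Nat.exists_eq_add_of_le h3
      rw [dist_pow_smul_pow_smul, Nat.add_sub_cancel_left]
    unfold gromovProduct at hg
    rw [e1, e2, e3] at hg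
    simp only [hA] at *
    linarith
  set L := N1 + N2 with hL
  have iter : ∀ j : ℕ, A (L + 2 * n * j) ≤ A L + 2 * δ * j := by
    intro j
    induction j with
    | zero => simp
    | succ j ih =>
      have h1 := step (L + 2 * n * j + n) (by omega) (by omega) (by omega)
      rw [Nat.add_sub_cancel] at h1
      have e : L + 2 * n * (j + 1) = L + 2 * n * j + n + n := by ring
      rw [e]
      push_cast
      linarith
  obtain ⟨j, hj⟩ := exists_nat_gt (A L + c)
  have h1 := iter j
  have h2 := H (L + 2 * n * j)
  have h3 : (2 * δ + 2) * j ≤ ((L + 2 * n * j : ℕ) : ℝ) / K := by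
    rw [le_div_iff₀ hK0]
    push_cast
    have : (0 : ℝ) ≤ L := Nat.cast_nonneg _
    have hj0 : (0 : ℝ) ≤ j := Nat.cast_nonneg _
    nlinarith [mul_le_mul_of_nonneg_right hn hj0]
  have hj0 : (0 : ℝ) ≤ j := Nat.cast_nonneg _
  simp only [hA] at *
  linarith

/-- The ordered pair `∂_± h = (∂_- h, ∂_+ h)`. -/
noncomputable def endPair (h : Γ) (hh : IsLoxodromic X h) : BoundaryPair X :=
  ⟨(repellingPoint h hh, attractingPoint h hh), repellingPoint_ne_attractingPoint h hh⟩

/-- The unordered pair `∂h = {∂_- h, ∂_+ h}`. -/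
noncomputable def endSet (h : Γ) (hh : IsLoxodromic X h) : BoundaryTwoSet X :=
  (endPair h hh).toTwoSet

variable (X) in
/-- `g` and `h` are independent loxodromic elements. -/
def AreIndependent (g h : Γ) : Prop :=
  ∃ (hg : IsLoxodromic X g) (hh : IsLoxodromic X h), Disjoint (endSet g hg).1 (endSet h hh).1

end EndPoints

/-- `ℓ` is a quasi-axis of `h`. -/
def IsQuasiAxis (h : Γ) (l : ℝ → X) : Prop :=
  Continuous l ∧ IsQuasiIsometricEmbedding l ∧ ∃ T : ℝ, 0 < T ∧ ∀ t, h • l t = l (t + T)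

/-- `π : A → B` is a closest point map. -/
def IsClosestPointMap {A B : Set X} (π : A → B) : Prop :=
  ∀ a : A, ∀ b : B, dist (a : X) (π a : X) ≤ dist (a : X) (b : X)

/-! ### The WWPD properties -/

variable [IsGromovHyperbolic X]

/-- Equivariant acylindricity modulo left cosets of `Stab(∂_± h)`. -/
def WWPDAcylindrical (h : Γ) (hh : IsLoxodromic X h) : Prop :=
  ∀ x : X, ∀ R : ℝ, 0 < R → ∃ M : ℕ, 1 ≤ M ∧ ∀ Z : Set Γ,
    (∀ g ∈ Z, dist x (g • x) < R ∧ dist (h ^ M • x) (g • h ^ M • x) < R) →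
    (∀ g ∈ Z, ∀ k ∈ Z, g ≠ k → g⁻¹ * k ∉ MulAction.stabilizer Γ (endPair h hh)) →
    Z.Finite

/-- Equivariantly discrete end points, unordered form: the orbit of `∂h` in `∂²X` is discrete. -/
def WWPDDiscreteUnordered (h : Γ) (hh : IsLoxodromic X h) : Prop :=
  IsDiscrete (MulAction.orbit Γ (endSet h hh))

/-- Equivariantly discrete end points, ordered form: the orbit of `∂_± h` in `∂X × ∂X - Δ` is discrete. -/
def WWPDDiscreteOrdered (h : Γ) (hh : IsLoxodromic X h) : Prop :=
  IsDiscrete (MulAction.orbit Γ (endPair h hh))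

/-- Equivariantly bounded projections. -/
def WWPDBoundedProjections (h : Γ) (hh : IsLoxodromic X h) : Prop :=
  ∀ l : ℝ → X, IsQuasiAxis h l → ∃ D : ℝ, 0 ≤ D ∧
    ∀ g : Γ, g ∉ MulAction.stabilizer Γ (endSet h hh) →
      ∀ π : (g • Set.range l : Set X) → (Set.range l : Set X), IsClosestPointMap π →
        ∀ a b, dist (π a : X) (π b : X) ≤ D

/-- The elements of the sequence lie in pairwise different left cosets of `Stab(∂_± h)`. -/
def PairwiseDifferentCosets (h : Γ) (hh : IsLoxodromic X h) (g : ℕ → Γ) : Prop :=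
  ∀ i j, i ≠ j → (g i)⁻¹ * g j ∉ MulAction.stabilizer Γ (endPair h hh)

/-- There is `R > 0` such that longer and longer initial segments of the sequence `h ^ m • x` are
eventually moved less than `R` by the `g i`. -/
def EventuallyUnmoved (h : Γ) (g : ℕ → Γ) (x : X) : Prop :=
  ∃ R : ℝ, 0 < R ∧ ∀ M : ℕ, ∃ I : ℕ, ∀ m i : ℕ, m ≤ M → I ≤ i →
    dist (g i • h ^ m • x) (h ^ m • x) < R

/-- No bad sequence, form with all base points. -/
def WWPDNoBadSequenceForall (h : Γ) (hh : IsLoxodromic X h) : Prop :=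
  ¬ ∃ g : ℕ → Γ, PairwiseDifferentCosets h hh g ∧ ∀ x : X, EventuallyUnmoved h g x

/-- No bad sequence, form with some base point. -/
def WWPDNoBadSequenceExists (h : Γ) (hh : IsLoxodromic X h) : Prop :=
  ¬ ∃ g : ℕ → Γ, PairwiseDifferentCosets h hh g ∧ ∃ x : X, EventuallyUnmoved h g x

variable (X) in
/-- `h` is WWPD: it is loxodromic and satisfies the properties above. -/
def IsWWPD (h : Γ) : Prop :=
  ∃ hh : IsLoxodromic X h, WWPDAcylindrical h hh ∧ WWPDDiscreteUnordered h hh ∧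
    WWPDDiscreteOrdered h hh ∧ WWPDBoundedProjections h hh ∧ WWPDNoBadSequenceForall h hh ∧
    WWPDNoBadSequenceExists h hh

end Action

end HyperbolicAction

open HyperbolicAction

/-!
The orbit `n ↦ h ^ n • x` of a loxodromic element is a coarse geodesic: because its two ends are
distinct, the triangle inequality is almost an equality for points of the orbit in their order
(`IsLoxodromic.exists_isRuler`). Everything is deduced from this and from the four point inequality
for Gromov products; stability of quasi-geodesics is not needed.

The bridge between the boundary and the space consists of two statements. If `g` carries the ends of
`h` close to the ends of `u`, where `u` is `h` or `h⁻¹`, then for a suitable `k` the element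
`g * h ^ k` carries a long segment of the orbit of `h` to the orbit of `u`, up to a bounded error
(`IsLoxodromic.exists_dist_zpowOrbit_le`); the converse is
`IsLoxodromic.exists_smul_endPair_mem_nhd`. The case `u = h⁻¹` describes elements that almost
exchange the two ends. The topology of the boundary enters only through the fact that the basic
neighbourhoods are neighbourhoods, so that discreteness of an orbit can be tested by them at one
point (`wwpdDiscreteOrdered_iff`, `wwpdDiscreteUnordered_iff`).

The equivalences then form two cycles through the absence of bad sequences.

* Acylindricity and the two forms of absence of bad sequences are equivalent, since an element that
  moves `x` and `h ^ M • x` a bounded amount moves the whole segment of the orbit between them a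
  bounded amount.
* If `∂_± h` is a limit of other points of its orbit, the bridge provides a bad sequence.
* If the orbit of `∂h` accumulates at `∂h` but the orbit of `∂_± h` does not accumulate at `∂_± h`,
  then there are elements that almost exchange the two ends of `h`, and a quotient of two of these,
  corrected by powers of `h`, almost fixes both, hence fixes both. So all of them agree on `∂_± h`,
  which means that they exchange the two ends exactly and fix `∂h`.
* If a translate of a quasi-axis has a long closest point projection to the quasi-axis, then the two
  are close to each other along a long segment, whose middle can be moved to the base point by
  powers of `h`; the bridge shows that the translating element, multiplied on both sides by powers
  of `h`, carries `∂h` close to itself.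
* A bad sequence moves long segments of the quasi-axis a bounded amount, so the projections are not
  bounded. Only here is it used that the space is geodesic, to construct a quasi-axis.

The further properties of WWPD elements follow from the dynamics of `h` on the boundary: if `g`
fixes the attracting point of `h` and moves its repelling point, then the pairs
`(h⁻¹ ^ i * g) • ∂_± h` converge to `∂_± h` and are different from it, against discreteness
(`WWPDDiscreteOrdered.smul_repellingPoint_eq`).
-/

namespace HyperbolicAction

/-! ### Gromov products and rulers -/

section Ruler

variable {X : Type*} [MetricSpace X]

variable (X) in
/-- `δ` is a constant in the four point inequality for Gromov products. -/
def IsHyperbolicityConstant (δ : ℝ) : Prop :=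
  0 ≤ δ ∧ ∀ p x y z : X,
    min (gromovProduct p x y) (gromovProduct p y z) - δ ≤ gromovProduct p x z

variable (X) in
theorem exists_isHyperbolicityConstant [IsGromovHyperbolic X] :
    ∃ δ : ℝ, IsHyperbolicityConstant X δ :=
  IsGromovHyperbolic.exists_delta

theorem IsHyperbolicityConstant.le_gromovProduct {δ : ℝ} (hδ : IsHyperbolicityConstant X δ)
    {p x y z : X} {a : ℝ} (h₁ : a ≤ gromovProduct p x y) (h₂ : a ≤ gromovProduct p y z) :
    a - δ ≤ gromovProduct p x z := by
  have := hδ.2 p x y z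
  have := le_min h₁ h₂
  linarith

theorem IsHyperbolicityConstant.le_gromovProduct₃ {δ : ℝ} (hδ : IsHyperbolicityConstant X δ)
    {p x y z w : X} {a : ℝ} (h₁ : a ≤ gromovProduct p x y) (h₂ : a ≤ gromovProduct p y z)
    (h₃ : a ≤ gromovProduct p z w) : a - 2 * δ ≤ gromovProduct p x w := by
  have := hδ.le_gromovProduct (hδ.le_gromovProduct h₁ h₂) (by linarith [hδ.1] : a - δ ≤ _)
  linarith

theorem gromovProduct_add_gromovProduct (p x y : X) :
    gromovProduct p x y + gromovProduct x p y = dist p x := by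
  unfold gromovProduct
  rw [dist_comm x p]
  ring

theorem gromovProduct_le_add_dist_base (p q x y : X) :
    gromovProduct p x y ≤ gromovProduct q x y + dist p q := by
  unfold gromovProduct
  have := dist_triangle p q x
  have := dist_triangle p q y
  linarith

theorem gromovProduct_le_add_dist_left (p x x' y : X) :
    gromovProduct p x y ≤ gromovProduct p x' y + dist x x' := by
  unfold gromovProduct
  have := dist_triangle p x' x
  have := dist_triangle x' x y
  rw [dist_comm x' x] at *
  linarith

/-- Two coarse segments `[x, z]` and `[x, z']` that stay together for a while: points `p`, `q` on
them at about the same distance from `x` are close to each other. -/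
theorem IsHyperbolicityConstant.dist_le_of_gromovProduct_le {δ : ℝ}
    (hδ : IsHyperbolicityConstant X δ) {x z z' p q : X} {B : ℝ}
    (hp : gromovProduct p x z ≤ B) (hq : gromovProduct q x z' ≤ B)
    (hz : dist x p ≤ gromovProduct x z z' + 2 * B) :
    dist p q ≤ |dist x p - dist x q| + 4 * B + 4 * δ := by
  have hB : 0 ≤ B := (gromovProduct_nonneg _ _ _).trans hp
  have h₁ := gromovProduct_add_gromovProduct x p z
  have h₂ := gromovProduct_add_gromovProduct x q z'
  have h₃ : min (dist x p) (dist x q) - 2 * B - 2 * δ ≤ gromovProduct x p q := by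
    refine hδ.le_gromovProduct₃ (y := z) (z := z') ?_ ?_ ?_
    · linarith [min_le_left (dist x p) (dist x q)]
    · linarith [min_le_left (dist x p) (dist x q)]
    · rw [gromovProduct_comm]
      linarith [min_le_right (dist x p) (dist x q)]
  have h₄ : dist p q = dist x p + dist x q - 2 * gromovProduct x p q := by
    unfold gromovProduct; ring
  have h₅ : dist x p + dist x q - 2 * min (dist x p) (dist x q) = |dist x p - dist x q| := by
    rcases le_total (dist x p) (dist x q) with h | h
    · rw [min_eq_left h, abs_of_nonpos (by linarith)]; ring
    · rw [min_eq_right h, abs_of_nonneg (by linarith)]; ring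
  linarith

/-- A discrete coarse geodesic: consecutive points are at bounded distance, and the triangle
inequality is an equality up to `2 * B` for every triple of points in their order. The
parametrization is not required to be proportional to arc length. -/
structure IsRuler (γ : ℤ → X) (B : ℝ) : Prop where
  dist_succ_le : ∀ i, dist (γ i) (γ (i + 1)) ≤ B
  gromovProduct_le : ∀ i j k, i ≤ j → j ≤ k → gromovProduct (γ j) (γ i) (γ k) ≤ B

theorem IsRuler.neg {γ : ℤ → X} {B : ℝ} (h : IsRuler γ B) : IsRuler (fun n => γ (-n)) B where
  dist_succ_le i := by
    have := h.dist_succ_le (-(i + 1))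
    rw [dist_comm]
    simpa using this
  gromovProduct_le i j k hij hjk := by
    rw [gromovProduct_comm]
    exact h.gromovProduct_le _ _ _ (by omega) (by omega)

/-- A discrete intermediate value theorem. -/
theorem exists_le_and_le_add_or_eq {f : ℤ → ℝ} {B c : ℝ} (hf : ∀ i, f (i + 1) ≤ f i + B) {a b : ℤ}
    (hab : a ≤ b) (ha : f a ≤ c) :
    ∃ j, a ≤ j ∧ j ≤ b ∧ f j ≤ c ∧ (c ≤ f j + B ∨ j = b) := by
  induction b, hab using Int.leInduction with
  | base => exact ⟨a, le_rfl, le_rfl, ha, Or.inr rfl⟩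
  | succ b hab ih =>
    obtain ⟨j, h₁, h₂, h₃, h₄⟩ := ih
    rcases h₄ with h₄ | rfl
    · exact ⟨j, h₁, by omega, h₃, Or.inl h₄⟩
    · rcases le_or_gt (f (j + 1)) c with h | h
      · exact ⟨j + 1, by omega, le_rfl, h, Or.inr rfl⟩
      · exact ⟨j, h₁, by omega, h₃, Or.inl (h.le.trans (hf j))⟩

theorem IsRuler.dist_succ_le_add {γ : ℤ → X} {B : ℝ} (h : IsRuler γ B) (x : X) (i : ℤ) :
    dist x (γ (i + 1)) ≤ dist x (γ i) + B :=
  (dist_triangle _ (γ i) _).trans (by linarith [h.dist_succ_le i])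

/-- A point between two points of a ruler, in the sense of Gromov products, is close to the
ruler. -/
theorem IsRuler.exists_dist_le {δ : ℝ} (hδ : IsHyperbolicityConstant X δ) {γ : ℤ → X} {B B' : ℝ}
    (h : IsRuler γ B) (hB : 0 ≤ B) {p : X} {a b : ℤ} (hp : gromovProduct p (γ a) (γ b) ≤ B') :
    ∃ j, dist p (γ j) ≤ 5 * B + 6 * B' + 4 * δ := by
  wlog hab : a ≤ b generalizing a b
  · exact this (by rwa [gromovProduct_comm]) (by omega)
  have hB' : 0 ≤ B' := (gromovProduct_nonneg _ _ _).trans hp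
  have e : dist (γ a) p + dist p (γ b) - dist (γ a) (γ b) = 2 * gromovProduct p (γ a) (γ b) := by
    unfold gromovProduct; rw [dist_comm p (γ a)]; ring
  obtain ⟨j, h₁, h₂, h₃, h₄⟩ := exists_le_and_le_add_or_eq (f := fun i => dist (γ a) (γ i))
    (c := dist (γ a) p) (fun i => h.dist_succ_le_add _ i) hab (by simp)
  have h₅ : |dist (γ a) p - dist (γ a) (γ j)| ≤ B + 2 * B' := by
    rw [abs_of_nonneg (by linarith)]
    rcases h₄ with h₄ | rfl
    · linarith
    · linarith [dist_nonneg (x := p) (y := γ j)]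
  refine ⟨j, ?_⟩
  have h₆ := hδ.dist_le_of_gromovProduct_le (x := γ a) (z := γ b) (z' := γ b) (p := p) (q := γ j)
    (B := B' + B) (by linarith) ((h.gromovProduct_le a j b h₁ h₂).trans (by linarith)) ?_
  · linarith
  · have : gromovProduct (γ a) (γ b) (γ b) = dist (γ a) (γ b) := by
      unfold gromovProduct; rw [dist_self]; ring
    linarith [dist_nonneg (x := p) (y := γ b)]

/-- A coarse closest point projection to a ruler is a coarse perpendicular foot. -/
theorem IsRuler.gromovProduct_le_of_closest {δ : ℝ} (hδ : IsHyperbolicityConstant X δ)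
    {γ : ℤ → X} {B C : ℝ} (h : IsRuler γ B) (hB : 0 ≤ B) {y : X} {i : ℤ}
    (hi : ∀ n, dist y (γ i) ≤ dist y (γ n) + C) (j : ℤ) :
    gromovProduct (γ i) y (γ j) ≤ C + 4 * B + 2 * δ := by
  wlog hij : i ≤ j generalizing γ i j
  · have := this (γ := fun n => γ (-n)) (i := -i) h.neg (fun n => by simpa using hi (-n)) (-j)
      (by omega)
    simpa using this
  set τ := gromovProduct (γ i) y (γ j) with hτ
  have hτj : τ ≤ dist (γ i) (γ j) := by
    rw [hτ, gromovProduct_comm]; exact gromovProduct_le_left _ _ _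
  -- `γ n` is the point of the ruler at distance about `τ` from `γ i` in the direction of `γ j`.
  obtain ⟨n, h₁, h₂, h₃, h₄⟩ := exists_le_and_le_add_or_eq (f := fun k => dist (γ i) (γ k))
    (c := τ) (fun k => h.dist_succ_le_add _ k) hij
    (by simpa using gromovProduct_nonneg (γ i) y (γ j))
  have h₅ : τ ≤ dist (γ i) (γ n) + B := by
    rcases h₄ with h₄ | rfl
    · exact h₄
    · linarith
  have h₆ := gromovProduct_add_gromovProduct (γ i) (γ n) (γ j)
  have h₇ := h.gromovProduct_le i n j h₁ h₂
  have h₈ : τ - 2 * B - δ ≤ gromovProduct (γ i) y (γ n) := by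
    refine hδ.le_gromovProduct (y := γ j) (by linarith) ?_
    rw [gromovProduct_comm]
    linarith
  have h₉ : dist y (γ n) = dist (γ i) y + dist (γ i) (γ n) - 2 * gromovProduct (γ i) y (γ n) := by
    unfold gromovProduct; ring
  have := hi n
  rw [dist_comm y (γ i)] at this
  linarith

end Ruler

/-! ### The topology of the boundary -/

section Boundary

variable {X : Type*} [MetricSpace X]

theorem eventually_prod_atTop_iff {P : ℕ → ℕ → Prop} :
    (∀ᶠ n : ℕ × ℕ in atTop, P n.1 n.2) ↔ ∃ N, ∀ i j, N ≤ i → N ≤ j → P i j := by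
  rw [eventually_atTop]
  constructor
  · rintro ⟨⟨a, b⟩, h⟩
    exact ⟨max a b, fun i j hi hj => h (i, j) ⟨(le_max_left _ _).trans hi,
      (le_max_right _ _).trans hj⟩⟩
  · rintro ⟨N, h⟩
    exact ⟨(N, N), fun n hn => h _ _ hn.1 hn.2⟩

theorem SeqAsymptotic.exists_le {x y : ℕ → X} (h : SeqAsymptotic x y) (p : X) (r : ℝ) :
    ∃ N, ∀ i j, N ≤ i → N ≤ j → r ≤ gromovProduct p (x i) (y j) :=
  eventually_prod_atTop_iff.1 ((h p).eventually_ge_atTop r)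

theorem seqAsymptotic_of_exists_le {x y : ℕ → X} (p : X)
    (h : ∀ r, ∃ N, ∀ i j, N ≤ i → N ≤ j → r ≤ gromovProduct p (x i) (y j)) :
    SeqAsymptotic x y :=
  seqAsymptotic_of_basepoint p (tendsto_atTop.2 fun r => eventually_prod_atTop_iff.2 (h r))

/-- If two sequences converge at infinity to different points, their Gromov products are
bounded. -/
theorem exists_gromovProduct_le_of_not_seqAsymptotic [IsGromovHyperbolic X] {x y : ℕ → X}
    (hx : SeqAsymptotic x x) (hy : SeqAsymptotic y y) (h : ¬ SeqAsymptotic x y) (p : X) :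
    ∃ E N, ∀ i j, N ≤ i → N ≤ j → gromovProduct p (x i) (y j) ≤ E := by
  obtain ⟨δ, hδ⟩ := exists_isHyperbolicityConstant X
  by_contra! hcon
  refine h (seqAsymptotic_of_exists_le p fun r => ?_)
  obtain ⟨N₁, h₁⟩ := hx.exists_le p (r + 2 * δ)
  obtain ⟨N₂, h₂⟩ := hy.exists_le p (r + 2 * δ)
  obtain ⟨i₀, j₀, hi₀, hj₀, h₀⟩ := hcon (r + 2 * δ) (max N₁ N₂)
  refine ⟨max N₁ N₂, fun i j hi hj => ?_⟩
  rw [max_le_iff] at *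
  have := hδ.le_gromovProduct₃ (h₁ i i₀ hi.1 hi₀.1) h₀.le (h₂ j₀ j hj₀.2 hj.2)
  linarith

variable [IsGromovHyperbolic X]

/-- The boundary point to which a sequence converges. -/
def boundaryPoint (x : GromovSeq X) : GromovBoundary X :=
  (⟦x⟧ : Quotient (gromovSeqSetoid X))

theorem exists_boundaryPoint_eq (ξ : GromovBoundary X) : ∃ x, boundaryPoint x = ξ :=
  Quotient.exists_rep ξ

theorem boundaryPoint_eq_iff {x y : GromovSeq X} :
    boundaryPoint x = boundaryPoint y ↔ SeqAsymptotic x.1 y.1 :=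
  ⟨fun h => Quotient.exact h, fun h => Quotient.sound h⟩

theorem mem_boundaryNhd_of_le {p : X} {x y : GromovSeq X} {r : ℝ} (N : ℕ)
    (h : ∀ i j, N ≤ i → N ≤ j → r ≤ gromovProduct p (x.1 i) (y.1 j)) :
    boundaryPoint y ∈ boundaryNhd p (boundaryPoint x) r :=
  ⟨x, y, rfl, rfl, eventually_prod_atTop_iff.2 ⟨N, h⟩⟩

theorem exists_le_of_mem_boundaryNhd {δ : ℝ} (hδ : IsHyperbolicityConstant X δ) {p : X}
    {x y : GromovSeq X} {r : ℝ} (h : boundaryPoint y ∈ boundaryNhd p (boundaryPoint x) r) :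
    ∃ N, ∀ i j, N ≤ i → N ≤ j → r - 2 * δ ≤ gromovProduct p (x.1 i) (y.1 j) := by
  obtain ⟨u, v, hu, hv, huv⟩ := h
  obtain ⟨N₁, h₁⟩ := (boundaryPoint_eq_iff.1 hu.symm).exists_le p r
  obtain ⟨N₂, h₂⟩ := (eventually_prod_atTop_iff
    (P := fun i j => r ≤ gromovProduct p (u.1 i) (v.1 j))).1 huv
  obtain ⟨N₃, h₃⟩ := (boundaryPoint_eq_iff.1 hv).exists_le p r
  refine ⟨N₁ + N₂ + N₃, fun i j hi hj => ?_⟩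
  exact hδ.le_gromovProduct₃ (h₁ i (N₁ + N₂ + N₃) (by omega) (by omega))
    (h₂ _ (N₁ + N₂ + N₃) (by omega) (by omega)) (h₃ _ j (by omega) (by omega))

theorem mem_boundaryNhd_self (p : X) (ξ : GromovBoundary X) (r : ℝ) : ξ ∈ boundaryNhd p ξ r := by
  obtain ⟨x, rfl⟩ := exists_boundaryPoint_eq ξ
  obtain ⟨N, hN⟩ := x.2.exists_le p r
  exact mem_boundaryNhd_of_le N hN

theorem eq_of_forall_mem_boundaryNhd {p : X} {ξ η : GromovBoundary X}
    (h : ∀ r, η ∈ boundaryNhd p ξ r) : η = ξ := by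
  obtain ⟨δ, hδ⟩ := exists_isHyperbolicityConstant X
  obtain ⟨x, rfl⟩ := exists_boundaryPoint_eq ξ
  obtain ⟨y, rfl⟩ := exists_boundaryPoint_eq η
  refine (boundaryPoint_eq_iff.2 (seqAsymptotic_of_exists_le p fun r => ?_)).symm
  obtain ⟨N, hN⟩ := exists_le_of_mem_boundaryNhd hδ (h (r + 2 * δ))
  exact ⟨N, fun i j hi hj => by linarith [hN i j hi hj]⟩

theorem boundaryNhd_trans {δ : ℝ} (hδ : IsHyperbolicityConstant X δ) {p : X}
    {ξ η ζ : GromovBoundary X} {r : ℝ} (h₁ : η ∈ boundaryNhd p ξ r)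
    (h₂ : ζ ∈ boundaryNhd p η r) : ζ ∈ boundaryNhd p ξ (r - 3 * δ) := by
  obtain ⟨x, rfl⟩ := exists_boundaryPoint_eq ξ
  obtain ⟨y, rfl⟩ := exists_boundaryPoint_eq η
  obtain ⟨z, rfl⟩ := exists_boundaryPoint_eq ζ
  obtain ⟨N₁, h₁⟩ := exists_le_of_mem_boundaryNhd hδ h₁
  obtain ⟨N₂, h₂⟩ := exists_le_of_mem_boundaryNhd hδ h₂
  refine mem_boundaryNhd_of_le (max N₁ N₂) fun i j hi hj => ?_
  rw [max_le_iff] at *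
  have := hδ.le_gromovProduct (h₁ i (max N₁ N₂) hi.1 (le_max_left _ _))
    (h₂ (max N₁ N₂) j (le_max_right _ _) hj.2)
  linarith

theorem boundaryNhd_subset_boundaryNhd (p q : X) (ξ : GromovBoundary X) (r : ℝ) :
    boundaryNhd p ξ (r + dist p q) ⊆ boundaryNhd q ξ r := by
  rintro η ⟨x, y, hx, hy, h⟩
  refine ⟨x, y, hx, hy, h.mono fun n hn => ?_⟩
  have := gromovProduct_le_add_dist_base p q (x.1 n.1) (y.1 n.2)
  linarith

/-- The basic neighbourhoods need not be open, but by `boundaryNhd_trans` their interiors contain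
the centre. -/
theorem boundaryNhd_mem_nhds (p : X) (ξ : GromovBoundary X) (r : ℝ) :
    boundaryNhd p ξ r ∈ 𝓝 ξ := by
  obtain ⟨δ, hδ⟩ := exists_isHyperbolicityConstant X
  refine mem_nhds_iff.2 ⟨{η | ∃ s, boundaryNhd p η s ⊆ boundaryNhd p ξ r}, ?_, ?_, r, subset_rfl⟩
  · rintro η ⟨s, hs⟩
    exact hs (mem_boundaryNhd_self p η s)
  · rintro η ⟨s, hs⟩ q
    refine ⟨s + 3 * δ + dist q p, fun ζ hζ => ⟨s + 3 * δ, fun ω hω => hs ?_⟩⟩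
    have := boundaryNhd_trans hδ (boundaryNhd_subset_boundaryNhd q p η _ hζ) hω
    simpa using this

theorem exists_boundaryNhd_subset {U : Set (GromovBoundary X)} {ξ : GromovBoundary X}
    (hU : U ∈ 𝓝 ξ) (p : X) : ∃ r, boundaryNhd p ξ r ⊆ U := by
  obtain ⟨V, hVU, hV, hξ⟩ := mem_nhds_iff.1 hU
  obtain ⟨r, hr⟩ := hV ξ hξ p
  exact ⟨r, hr.trans hVU⟩

/-- The basic neighbourhood of a pair of distinct boundary points: both coordinates are in the basic
neighbourhoods with parameter `r`. -/
def BoundaryPair.nhd (p : X) (q : BoundaryPair X) (r : ℝ) : Set (BoundaryPair X) :=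
  {q' | q'.1.1 ∈ boundaryNhd p q.1.1 r ∧ q'.1.2 ∈ boundaryNhd p q.1.2 r}

theorem BoundaryPair.nhd_anti (p : X) (q : BoundaryPair X) {r s : ℝ} (hrs : r ≤ s) :
    q.nhd p s ⊆ q.nhd p r :=
  fun _ h => ⟨boundaryNhd_anti _ _ hrs h.1, boundaryNhd_anti _ _ hrs h.2⟩

theorem BoundaryPair.eq_of_forall_mem_nhd {p : X} {q q' : BoundaryPair X}
    (h : ∀ r, q' ∈ q.nhd p r) : q' = q :=
  Subtype.ext (Prod.ext (eq_of_forall_mem_boundaryNhd fun r => (h r).1)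
    (eq_of_forall_mem_boundaryNhd fun r => (h r).2))

theorem BoundaryPair.mem_nhds_iff {U : Set (BoundaryPair X)} {q : BoundaryPair X} (p : X) :
    U ∈ 𝓝 q ↔ ∃ r, q.nhd p r ⊆ U := by
  have hq : U ∈ 𝓝 q ↔ ∃ V ∈ 𝓝 q.1, Subtype.val ⁻¹' V ⊆ U := by
    rw [nhds_induced, mem_comap]
  rw [hq]
  constructor
  · rintro ⟨V, hV, hVU⟩
    rw [nhds_prod_eq, Filter.mem_prod_iff] at hV
    obtain ⟨A, hA, B, hB, hAB⟩ := hV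
    obtain ⟨r, hr⟩ := exists_boundaryNhd_subset hA p
    obtain ⟨s, hs⟩ := exists_boundaryNhd_subset hB p
    exact ⟨max r s, fun q' h => hVU (hAB
      ⟨hr (boundaryNhd_anti _ _ (le_max_left r s) h.1),
        hs (boundaryNhd_anti _ _ (le_max_right r s) h.2)⟩)⟩
  · rintro ⟨r, hr⟩
    exact ⟨boundaryNhd p q.1.1 r ×ˢ boundaryNhd p q.1.2 r,
      prod_mem_nhds (boundaryNhd_mem_nhds _ _ _) (boundaryNhd_mem_nhds _ _ _),
      fun q' h => hr h⟩

/-- The exchange of the two points of a pair. -/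
def BoundaryPair.swap (q : BoundaryPair X) : BoundaryPair X := ⟨(q.1.2, q.1.1), q.2.symm⟩

theorem BoundaryPair.continuous_swap : Continuous (BoundaryPair.swap (X := X)) :=
  (_root_.continuous_swap.comp continuous_subtype_val).subtype_mk _

theorem BoundaryPair.toTwoSet_eq_iff {q q' : BoundaryPair X} :
    q.toTwoSet = q'.toTwoSet ↔ q = q' ∨ q = q'.swap := by
  have h : q.toTwoSet = q'.toTwoSet ↔ ({q.1.1, q.1.2} : Set (GromovBoundary X)) =
      {q'.1.1, q'.1.2} := Subtype.ext_iff
  rw [h, Set.pair_eq_pair_iff, Subtype.ext_iff, Subtype.ext_iff, Prod.ext_iff, Prod.ext_iff]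
  rfl

theorem BoundaryPair.isOpenMap_toTwoSet : IsOpenMap (BoundaryPair.toTwoSet (X := X)) := by
  intro U hU
  change IsOpen (BoundaryPair.toTwoSet ⁻¹' (BoundaryPair.toTwoSet '' U))
  have : BoundaryPair.toTwoSet ⁻¹' (BoundaryPair.toTwoSet '' U) = U ∪ BoundaryPair.swap ⁻¹' U := by
    ext q
    simp only [Set.mem_preimage, Set.mem_image, Set.mem_union, toTwoSet_eq_iff]
    constructor
    · rintro ⟨q', h, rfl | rfl⟩
      · exact Or.inl h
      · exact Or.inr h
    · rintro (h | h)
      · exact ⟨q, h, Or.inl rfl⟩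
      · exact ⟨_, h, Or.inr rfl⟩
  rw [this]
  exact hU.union (hU.preimage continuous_swap)

end Boundary

section BoundaryAction

variable {Γ : Type*} [Group Γ] {X : Type*} [MetricSpace X] [MulAction Γ X]
  [IsIsometricSMul Γ X] [IsGromovHyperbolic X]

/-- The translate of a sequence converging at infinity. -/
def smulSeq (g : Γ) (x : GromovSeq X) : GromovSeq X := ⟨fun n => g • x.1 n, x.2.smul g⟩

theorem smul_boundaryPoint (g : Γ) (x : GromovSeq X) :
    g • boundaryPoint x = boundaryPoint (smulSeq g x) := rfl

theorem smul_mem_boundaryNhd (g : Γ) {p : X} {ξ η : GromovBoundary X} {r : ℝ}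
    (h : η ∈ boundaryNhd p ξ r) : g • η ∈ boundaryNhd (g • p) (g • ξ) r := by
  obtain ⟨x, y, rfl, rfl, h⟩ := h
  refine ⟨smulSeq g x, smulSeq g y, rfl, rfl, h.mono fun n hn => ?_⟩
  simpa only [smulSeq, gromovProduct_smul] using hn

theorem smul_mem_nhd (g : Γ) {p : X} {q q' : BoundaryPair X} {r : ℝ}
    (h : q' ∈ q.nhd p r) : g • q' ∈ (g • q).nhd (g • p) r :=
  ⟨smul_mem_boundaryNhd g h.1, smul_mem_boundaryNhd g h.2⟩

theorem smul_toTwoSet (g : Γ) (q : BoundaryPair X) : g • q.toTwoSet = (g • q).toTwoSet :=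
  Subtype.ext (Set.image_pair _ _ _)

theorem smul_swap (g : Γ) (q : BoundaryPair X) : g • q.swap = (g • q).swap := rfl

end BoundaryAction

/-! ### Orbits of loxodromic elements -/

section Orbit

variable {Γ : Type*} [Group Γ] {X : Type*} [MulAction Γ X]

/-- The orbit `n ↦ h ^ n • x` of the cyclic group generated by `h`. -/
def zpowOrbit (h : Γ) (x : X) (n : ℤ) : X := h ^ n • x

theorem zpowOrbit_natCast (h : Γ) (x : X) (n : ℕ) : zpowOrbit h x n = h ^ n • x := by
  rw [zpowOrbit, zpow_natCast]

theorem zpowOrbit_zero (h : Γ) (x : X) : zpowOrbit h x 0 = x := by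
  rw [zpowOrbit, zpow_zero, one_smul]

theorem zpowOrbit_inv (h : Γ) (x : X) : zpowOrbit h⁻¹ x = fun n => zpowOrbit h x (-n) := by
  funext n
  rw [zpowOrbit, zpowOrbit, inv_zpow']

theorem zpow_smul_zpowOrbit (h : Γ) (x : X) (m n : ℤ) :
    h ^ m • zpowOrbit h x n = zpowOrbit h x (m + n) := by
  rw [zpowOrbit, zpowOrbit, zpow_add, mul_smul]

variable [MetricSpace X]

theorem IsRuler.zpowOrbit_inv {h : Γ} {x : X} {B : ℝ} (hB : IsRuler (zpowOrbit h x) B) :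
    IsRuler (zpowOrbit h⁻¹ x) B := by
  rw [HyperbolicAction.zpowOrbit_inv]
  exact hB.neg

theorem IsRuler.zpowOrbit_of_eq_or_eq_inv {h u : Γ} {x : X} {B : ℝ}
    (hB : IsRuler (zpowOrbit h x) B) (hu : u = h ∨ u = h⁻¹) : IsRuler (zpowOrbit u x) B := by
  rcases hu with rfl | rfl
  · exact hB
  · exact hB.zpowOrbit_inv

theorem IsRuler.gromovProduct_pow_smul_le {h : Γ} {x : X} {B : ℝ}
    (hB : IsRuler (zpowOrbit h x) B) {m n : ℕ} (hmn : m ≤ n) :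
    gromovProduct (h ^ m • x) x (h ^ n • x) ≤ B := by
  have := hB.gromovProduct_le 0 m n (by omega) (by omega)
  simpa only [zpowOrbit_natCast, zpowOrbit_zero] using this

theorem eq_or_eq_inv_inv {h u : Γ} (hu : u = h ∨ u = h⁻¹) : u⁻¹ = h⁻¹ ∨ u⁻¹ = h⁻¹⁻¹ := by
  rcases hu with rfl | rfl
  · exact Or.inl rfl
  · exact Or.inr rfl

variable [IsIsometricSMul Γ X]

theorem dist_zpowOrbit (h : Γ) (x : X) (m n k : ℤ) :
    dist (zpowOrbit h x (k + m)) (zpowOrbit h x (k + n)) =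
      dist (zpowOrbit h x m) (zpowOrbit h x n) := by
  rw [← zpow_smul_zpowOrbit, ← zpow_smul_zpowOrbit, dist_smul]

theorem dist_inv_pow_smul (h : Γ) (x : X) (n : ℕ) :
    dist x (h⁻¹ ^ n • x) = dist x (h ^ n • x) := by
  rw [inv_pow, ← dist_smul (h ^ n), smul_inv_smul, dist_comm]

theorem dist_pow_smul_of_eq_or_eq_inv {h u : Γ} (hu : u = h ∨ u = h⁻¹) (x : X) (n : ℕ) :
    dist x (u ^ n • x) = dist x (h ^ n • x) := by
  rcases hu with rfl | rfl
  · rfl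
  · exact dist_inv_pow_smul h x n

theorem dist_pow_smul_le (h : Γ) (x : X) (n : ℕ) :
    dist x (h ^ n • x) ≤ n * dist x (h • x) := by
  induction n with
  | zero => simp
  | succ n ih =>
    have h₁ := dist_triangle x (h ^ n • x) (h ^ (n + 1) • x)
    rw [pow_succ, mul_smul, dist_smul] at h₁
    rw [pow_succ, mul_smul]
    push_cast
    linarith

theorem IsLoxodromic.exists_le_dist {h : Γ} (hh : IsLoxodromic X h) (x : X) (r : ℝ) :
    ∃ L : ℕ, ∀ n, L ≤ n → r ≤ dist x (h ^ n • x) := by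
  obtain ⟨K, c, hK, -, H⟩ := hh.linear_growth x
  obtain ⟨L, hL⟩ := exists_nat_ge ((r + c) * K)
  refine ⟨L, fun n hn => ?_⟩
  have h₁ : r + c ≤ (n : ℝ) / K := by
    rw [le_div_iff₀ (by linarith)]
    exact hL.trans (by exact_mod_cast hn)
  linarith [H n]

/-- If `f` moves `x` a bounded amount and the rays `u ^ i • x` and `f • h ^ i • x` stay together, in
the sense of Gromov products, at least as far from `x` as `u ^ m • x` is, then they are close to
each other at time `m`. -/
theorem IsRuler.dist_pow_smul_smul_pow_smul_le {δ : ℝ} (hδ : IsHyperbolicityConstant X δ)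
    {h u f : Γ} {x : X} {B C E : ℝ} (hB : IsRuler (zpowOrbit h x) B) (hu : u = h ∨ u = h⁻¹)
    (hf : dist x (f • x) ≤ C) (hE : 0 ≤ E) {m n n' : ℕ} (hn : m ≤ n) (hn' : m ≤ n')
    (hz : dist x (u ^ m • x) ≤ gromovProduct x (u ^ n' • x) (f • h ^ n • x) + E) :
    dist (u ^ m • x) (f • h ^ m • x) ≤ C + 4 * (B + C + E) + 4 * δ := by
  have hC : 0 ≤ C := dist_nonneg.trans hf
  have h₁ := (hB.zpowOrbit_of_eq_or_eq_inv hu).gromovProduct_pow_smul_le hn'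
  have hB0 := (gromovProduct_nonneg _ _ _).trans h₁
  have h₂ : gromovProduct (f • h ^ m • x) x (f • h ^ n • x) ≤ B + C := by
    refine (gromovProduct_le_add_dist_left _ _ (f • x) _).trans (add_le_add ?_ hf)
    rw [gromovProduct_smul]
    exact hB.gromovProduct_pow_smul_le hn
  have h₃ := hδ.dist_le_of_gromovProduct_le (B := B + C + E) (h₁.trans (by linarith))
    (h₂.trans (by linarith)) (by linarith)
  have h₄ : |dist x (u ^ m • x) - dist x (f • h ^ m • x)| ≤ C := by
    rw [dist_pow_smul_of_eq_or_eq_inv hu, ← dist_smul f x (h ^ m • x)]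
    have := abs_dist_sub_le (f • x) x (f • h ^ m • x)
    rw [dist_comm (f • x) x] at this
    exact this.trans hf
  linarith

/-- If `f` moves `h ^ n • x` close to `u ^ n' • x` and moves `x` a bounded amount, then it
carries the segment of the orbit of `h` between `x` and `h ^ n • x` to the orbit of `u`. -/
theorem IsRuler.dist_pow_smul_smul_pow_smul_le_of_endpoints {δ : ℝ}
    (hδ : IsHyperbolicityConstant X δ) {h u f : Γ} {x : X} {B C : ℝ}
    (hB : IsRuler (zpowOrbit h x) B) (hu : u = h ∨ u = h⁻¹)
    (hf : dist x (f • x) ≤ C) {m n n' : ℕ} (hn : m ≤ n) (hn' : m ≤ n')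
    (hz : dist (u ^ n' • x) (f • h ^ n • x) ≤ C) :
    dist (u ^ m • x) (f • h ^ m • x) ≤ C + 4 * (B + C + (C + 2 * B)) + 4 * δ := by
  have hC : 0 ≤ C := dist_nonneg.trans hf
  have h₁ := (hB.zpowOrbit_of_eq_or_eq_inv hu).gromovProduct_pow_smul_le hn'
  have hB0 := (gromovProduct_nonneg _ _ _).trans h₁
  refine hB.dist_pow_smul_smul_pow_smul_le hδ hu hf (by linarith) hn hn' ?_
  have h₂ := gromovProduct_add_gromovProduct x (u ^ n' • x) (f • h ^ n • x)
  have h₃ : gromovProduct (u ^ n' • x) x (f • h ^ n • x) ≤ C := by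
    rw [gromovProduct_comm]
    exact (gromovProduct_le_left _ _ _).trans hz
  have h₄ := gromovProduct_add_gromovProduct x (u ^ m • x) (u ^ n' • x)
  have h₅ := gromovProduct_comm x (u ^ m • x) (u ^ n' • x)
  have h₆ := gromovProduct_le_left x (u ^ n' • x) (u ^ m • x)
  linarith

/-- If `f` moves `x` and `h ^ L • x` close to `x` and `u ^ L • x`, then the rays `u ^ i • x`
and `f • h ^ i • x` stay together about as far from `x` as `h ^ L • x` is. -/
theorem IsRuler.le_gromovProduct_pow_smul_smul_pow_smul {δ : ℝ} (hδ : IsHyperbolicityConstant X δ)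
    {h u f : Γ} {x : X} {B C : ℝ} (hB : IsRuler (zpowOrbit h x) B) (hu : u = h ∨ u = h⁻¹)
    (hf : dist x (f • x) ≤ C) {L i j : ℕ} (hL : dist (u ^ L • x) (f • h ^ L • x) ≤ C)
    (hi : L ≤ i) (hj : L ≤ j) : dist x (h ^ L • x) - B - C - 2 * δ ≤
      gromovProduct x (u ^ i • x) (f • h ^ j • x) := by
  have hC : 0 ≤ C := dist_nonneg.trans hf
  have h₁ := (hB.zpowOrbit_of_eq_or_eq_inv hu).gromovProduct_pow_smul_le hi
  have h₂ := hB.gromovProduct_pow_smul_le hj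
  have hB0 := (gromovProduct_nonneg _ _ _).trans h₁
  have e := dist_pow_smul_of_eq_or_eq_inv hu x L
  refine hδ.le_gromovProduct₃ (y := u ^ L • x) (z := f • h ^ L • x) ?_ ?_ ?_
  · have := gromovProduct_add_gromovProduct x (u ^ L • x) (u ^ i • x)
    rw [gromovProduct_comm]
    linarith
  · have h₃ := gromovProduct_add_gromovProduct x (u ^ L • x) (f • h ^ L • x)
    have h₄ : gromovProduct (u ^ L • x) x (f • h ^ L • x) ≤ C := by
      rw [gromovProduct_comm]
      exact (gromovProduct_le_left _ _ _).trans hL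
    linarith
  · have h₃ := gromovProduct_add_gromovProduct x (h ^ L • x) (h ^ j • x)
    have h₄ := gromovProduct_le_add_dist_base (f • x) x (f • h ^ L • x) (f • h ^ j • x)
    rw [gromovProduct_smul, dist_comm] at h₄
    linarith

variable [IsGromovHyperbolic X]

/-- The forward orbit of a loxodromic element, as a sequence converging at infinity. -/
def forwardOrbit {h : Γ} (hh : IsLoxodromic X h) (x : X) : GromovSeq X :=
  ⟨fun n => h ^ n • x, hh.seqAsymptotic x⟩

theorem attractingPoint_eq_boundaryPoint (h : Γ) (hh : IsLoxodromic X h) (x : X) :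
    attractingPoint h hh = boundaryPoint (forwardOrbit hh x) :=
  attractingPoint_eq h hh x

theorem repellingPoint_eq_boundaryPoint (h : Γ) (hh : IsLoxodromic X h) (x : X) :
    repellingPoint h hh = boundaryPoint (forwardOrbit hh.inv x) :=
  attractingPoint_eq h⁻¹ hh.inv x

theorem repellingPoint_inv (h : Γ) (hh : IsLoxodromic X h) :
    repellingPoint h⁻¹ hh.inv = attractingPoint h hh := by
  obtain ⟨x, -⟩ := id hh
  rw [repellingPoint_eq_boundaryPoint _ _ x, attractingPoint_eq_boundaryPoint _ _ x]
  exact congrArg boundaryPoint (Subtype.ext (by simp only [forwardOrbit, inv_inv]))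

theorem endPair_inv (h : Γ) (hh : IsLoxodromic X h) :
    endPair h⁻¹ hh.inv = (endPair h hh).swap :=
  Subtype.ext (Prod.ext (repellingPoint_inv h hh) rfl)

/-- Since its two ends are distinct, an orbit of a loxodromic element is a ruler. -/
theorem IsLoxodromic.exists_isRuler {h : Γ} (hh : IsLoxodromic X h) (x : X) :
    ∃ B, 0 ≤ B ∧ IsRuler (zpowOrbit h x) B := by
  have hne := repellingPoint_ne_attractingPoint h hh
  rw [repellingPoint_eq_boundaryPoint _ _ x, attractingPoint_eq_boundaryPoint _ _ x, Ne,
    boundaryPoint_eq_iff] at hne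
  obtain ⟨E, N, hE⟩ := exists_gromovProduct_le_of_not_seqAsymptotic (forwardOrbit hh.inv x).2
    (forwardOrbit hh x).2 hne x
  set d := dist x (h • x) with hd
  have hd0 : 0 ≤ d := dist_nonneg
  set B := max E ((N + 1) * d) with hBdef
  have hB₁ : (N + 1) * d ≤ B := le_max_right _ _
  have hB₂ : E ≤ B := le_max_left _ _
  have hd₁ : d ≤ B := by nlinarith [(Nat.cast_nonneg N : (0 : ℝ) ≤ N)]
  have small : ∀ m : ℕ, m ≤ N → dist x (h ^ m • x) ≤ B := by
    intro m hm
    have h₁ := dist_pow_smul_le h x m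
    have h₂ : (m : ℝ) ≤ N := by exact_mod_cast hm
    nlinarith
  -- Far out the distinctness of the ends applies; otherwise one of the two points is near `x`.
  have main : ∀ m n : ℕ, gromovProduct x (h⁻¹ ^ m • x) (h ^ n • x) ≤ B := by
    intro m n
    rcases le_total m N with hm | hm
    · refine (gromovProduct_le_left _ _ _).trans ?_
      rw [dist_inv_pow_smul]
      exact small m hm
    rcases le_total n N with hn | hn
    · rw [gromovProduct_comm]
      exact (gromovProduct_le_left _ _ _).trans (small n hn)
    · exact (hE m n hm hn).trans hB₂
  refine ⟨B, hd0.trans hd₁, ⟨fun i => ?_, fun i j k hij hjk => ?_⟩⟩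
  · have := dist_zpowOrbit h x 0 1 i
    rw [add_zero] at this
    rw [this, zpowOrbit_zero, zpowOrbit, zpow_one]
    exact hd₁
  · obtain ⟨m, hm⟩ := Int.eq_ofNat_of_zero_le (sub_nonneg.2 hij)
    obtain ⟨n, hn⟩ := Int.eq_ofNat_of_zero_le (sub_nonneg.2 hjk)
    have e₁ : zpowOrbit h x i = h ^ j • h⁻¹ ^ m • x := by
      rw [← zpow_natCast, inv_zpow', ← mul_smul, ← zpow_add, zpowOrbit]
      congr 2; omega
    have e₂ : zpowOrbit h x k = h ^ j • h ^ n • x := by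
      rw [← zpow_natCast, ← mul_smul, ← zpow_add, zpowOrbit]
      congr 2; omega
    rw [e₁, e₂, zpowOrbit, gromovProduct_smul]
    exact main m n

theorem smul_attractingPoint_mem_boundaryNhd {h u f : Γ} (hh : IsLoxodromic X h)
    (hu : IsLoxodromic X u) {x : X} {r : ℝ} (N : ℕ) (H : ∀ i j, N ≤ i → N ≤ j →
      r ≤ gromovProduct x (u ^ i • x) (f • h ^ j • x)) :
    f • attractingPoint h hh ∈ boundaryNhd x (attractingPoint u hu) r := by
  rw [attractingPoint_eq_boundaryPoint h hh x, attractingPoint_eq_boundaryPoint u hu x,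
    smul_boundaryPoint]
  exact mem_boundaryNhd_of_le N H

theorem exists_le_of_smul_attractingPoint_mem {δ : ℝ} (hδ : IsHyperbolicityConstant X δ)
    {h u f : Γ} (hh : IsLoxodromic X h) (hu : IsLoxodromic X u) {x : X} {r : ℝ}
    (H : f • attractingPoint h hh ∈ boundaryNhd x (attractingPoint u hu) r) :
    ∃ N, ∀ i j, N ≤ i → N ≤ j → r - 2 * δ ≤ gromovProduct x (u ^ i • x) (f • h ^ j • x) := by
  rw [attractingPoint_eq_boundaryPoint h hh x, attractingPoint_eq_boundaryPoint u hu x,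
    smul_boundaryPoint] at H
  exact exists_le_of_mem_boundaryNhd hδ H

/-- An isometry that carries a long segment of the orbit of `h` close to the orbit of `h` or of its
inverse, respecting the parametrization, carries the ends of `h` close to the ends of the
latter. -/
theorem IsLoxodromic.exists_smul_endPair_mem_nhd {h : Γ} (hh : IsLoxodromic X h) (x : X)
    (C r : ℝ) : ∃ L : ℕ, ∀ (u : Γ) (hu : IsLoxodromic X u), (u = h ∨ u = h⁻¹) → ∀ f : Γ,
      (∀ m : ℤ, |m| ≤ L → dist (zpowOrbit u x m) (f • zpowOrbit h x m) ≤ C) →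
      f • endPair h hh ∈ (endPair u hu).nhd x r := by
  obtain ⟨δ, hδ⟩ := exists_isHyperbolicityConstant X
  obtain ⟨B, -, hB⟩ := hh.exists_isRuler x
  obtain ⟨L, hL⟩ := hh.exists_le_dist x (r + B + C + 2 * δ)
  refine ⟨L, fun u hu huh f hf => ?_⟩
  have h₀ : dist x (f • x) ≤ C := by simpa only [zpowOrbit_zero] using hf 0 (by simp)
  refine ⟨smul_attractingPoint_mem_boundaryNhd hh.inv hu.inv L fun i j hi hj => ?_,
    smul_attractingPoint_mem_boundaryNhd hh hu L fun i j hi hj => ?_⟩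
  · have h₁ : dist (u⁻¹ ^ L • x) (f • h⁻¹ ^ L • x) ≤ C := by
      simpa only [zpowOrbit, ← inv_zpow', zpow_natCast] using hf (-L) (by simp)
    have := hB.zpowOrbit_inv.le_gromovProduct_pow_smul_smul_pow_smul hδ (eq_or_eq_inv_inv huh)
      h₀ h₁ hi hj
    rw [dist_inv_pow_smul] at this
    linarith [hL L le_rfl]
  · have h₁ : dist (u ^ L • x) (f • h ^ L • x) ≤ C := by
      simpa only [zpowOrbit_natCast] using hf L (by simp)
    have := hB.le_gromovProduct_pow_smul_smul_pow_smul hδ huh h₀ h₁ hi hj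
    linarith [hL L le_rfl]

/-- Conversely, an isometry that carries the ends of `h` close to the ends of `h` or of its inverse
carries a long segment of the orbit of `h` close to the orbit of the latter, after a shift of the
parametrization. -/
theorem IsLoxodromic.exists_dist_zpowOrbit_le {h : Γ} (hh : IsLoxodromic X h) (x : X) :
    ∃ C : ℝ, ∀ L : ℕ, ∃ r : ℝ, ∀ (u : Γ) (hu : IsLoxodromic X u), (u = h ∨ u = h⁻¹) → ∀ g : Γ,
      g • endPair h hh ∈ (endPair u hu).nhd x r →
      ∃ k : ℤ, ∀ m : ℤ, |m| ≤ L →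
        dist (zpowOrbit u x m) ((g * h ^ k) • zpowOrbit h x m) ≤ C := by
  obtain ⟨δ, hδ⟩ := exists_isHyperbolicityConstant X
  obtain ⟨B, hB0, hB⟩ := hh.exists_isRuler x
  set C₁ := 5 * B + 6 * (B + 2 * δ) + 4 * δ with hC₁
  refine ⟨C₁ + 4 * (B + C₁ + 0) + 4 * δ, fun L =>
    ⟨max (B + 4 * δ + 1) (L * dist x (h • x) + 2 * δ), fun u hu huh g hg => ?_⟩⟩
  set r := max (B + 4 * δ + 1) (L * dist x (h • x) + 2 * δ) with hr
  have hr₁ : B + 4 * δ + 1 ≤ r := le_max_left _ _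
  have hr₂ : L * dist x (h • x) + 2 * δ ≤ r := le_max_right _ _
  obtain ⟨N₁, h₁⟩ := exists_le_of_smul_attractingPoint_mem hδ hh.inv hu.inv hg.1
  obtain ⟨N₂, h₂⟩ := exists_le_of_smul_attractingPoint_mem hδ hh hu hg.2
  have huB := hB.zpowOrbit_of_eq_or_eq_inv huh
  -- `x` is between the two ends of the translated orbit, hence it is close to that orbit.
  obtain ⟨k, hk⟩ : ∃ k, dist x (g • zpowOrbit h x k) ≤ C₁ := by
    set n := max N₁ N₂
    have hle : gromovProduct (g⁻¹ • x) (zpowOrbit h x (-n : ℤ)) (zpowOrbit h x n) ≤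
        B + 2 * δ := by
      rw [← gromovProduct_smul g, smul_inv_smul]
      have h₃ : gromovProduct x (u⁻¹ ^ n • x) (u ^ n • x) ≤ B := by
        have := huB.gromovProduct_le (-n) 0 n (by omega) (by omega)
        rwa [zpowOrbit_zero, zpowOrbit_natCast, zpowOrbit, ← inv_zpow', zpow_natCast] at this
      by_contra! hcon
      rw [zpowOrbit_natCast, zpowOrbit, ← inv_zpow', zpow_natCast] at hcon
      have h₄ := h₁ n n (le_max_left _ _) (le_max_left _ _)
      have h₅ := h₂ n n (le_max_right _ _) (le_max_right _ _)
      have h₆ : min (r - 2 * δ) (gromovProduct x (g • h⁻¹ ^ n • x) (g • h ^ n • x)) - 2 * δ ≤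
          gromovProduct x (u⁻¹ ^ n • x) (u ^ n • x) := by
        refine hδ.le_gromovProduct₃ ((min_le_left _ _).trans h₄) (min_le_right _ _)
          ((min_le_left _ _).trans ?_)
        rwa [gromovProduct_comm]
      rcases min_choice (r - 2 * δ) (gromovProduct x (g • h⁻¹ ^ n • x) (g • h ^ n • x)) with h | h
      all_goals rw [h] at h₆; linarith
    obtain ⟨k, hk⟩ := hB.exists_dist_le hδ hB0 hle
    refine ⟨k, ?_⟩
    rwa [← dist_smul g, smul_inv_smul] at hk
  have hf : dist x ((g * h ^ k) • x) ≤ C₁ := by rwa [mul_smul]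
  have hL : ∀ m : ℕ, m ≤ L → dist x (h ^ m • x) ≤ r - 2 * δ := by
    intro m hm
    have h₃ := dist_pow_smul_le h x m
    have h₄ : (m : ℝ) ≤ L := by exact_mod_cast hm
    have h₅ : 0 ≤ dist x (h • x) := dist_nonneg
    nlinarith
  refine ⟨k, fun m hm => ?_⟩
  -- Nonnegative times use the attracting ends, nonpositive times the repelling ends. The same far
  -- point of the translated orbit has parameters `n` before and `n - k` after the shift by `k`.
  obtain ⟨m, rfl | rfl⟩ := m.eq_nat_or_neg
  · have hm' : m ≤ L := by simpa using hm
    set n := max N₂ m + k.natAbs with hn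
    have hkn : ((n - k).toNat : ℤ) = n - k := Int.toNat_of_nonneg (by omega)
    rw [zpowOrbit_natCast, zpowOrbit_natCast]
    refine hB.dist_pow_smul_smul_pow_smul_le hδ huh hf le_rfl (n := (n - k).toNat) (n' := n)
      (by omega) (by omega) ?_
    have e : (g * h ^ k) • h ^ (n - k).toNat • x = g • h ^ n • x := by
      rw [mul_smul, ← zpow_natCast, hkn, ← mul_smul (h ^ k), ← zpow_add, add_sub_cancel,
        zpow_natCast]
    rw [e, dist_pow_smul_of_eq_or_eq_inv huh, add_zero]
    exact (hL m hm').trans (h₂ n n (by omega) (by omega))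
  · have hm' : m ≤ L := by simpa using hm
    set n := max N₁ m + k.natAbs with hn
    have hkn : ((n + k).toNat : ℤ) = n + k := Int.toNat_of_nonneg (by omega)
    rw [zpowOrbit, zpowOrbit, ← inv_zpow', ← inv_zpow', zpow_natCast, zpow_natCast]
    refine hB.zpowOrbit_inv.dist_pow_smul_smul_pow_smul_le hδ (eq_or_eq_inv_inv huh) hf le_rfl
      (n := (n + k).toNat) (n' := n) (by omega) (by omega) ?_
    have e : (g * h ^ k) • h⁻¹ ^ (n + k).toNat • x = g • h⁻¹ ^ n • x := by
      rw [mul_smul, ← zpow_natCast, hkn, ← mul_smul (h ^ k), inv_zpow', ← zpow_add,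
        ← zpow_natCast, inv_zpow']
      congr 3; ring
    rw [e, dist_pow_smul_of_eq_or_eq_inv (eq_or_eq_inv_inv huh), dist_inv_pow_smul, add_zero]
    exact (hL m hm').trans (h₁ n n (by omega) (by omega))

/-- If the orbit of `h` and its translate by `g` have points close to each other at two places far
apart, then, after powers of `h` are used to move the middle of these places to `x`, the ends of the
translate are close to the ends of `h` or of its inverse. -/
theorem IsLoxodromic.exists_smul_endPair_mem_nhd_of_dist_le {h : Γ} (hh : IsLoxodromic X h)
    (x : X) (C r : ℝ) : ∃ N : ℝ, ∀ (g : Γ) (i j k l : ℤ),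
      dist (zpowOrbit h x i) (g • zpowOrbit h x k) ≤ C →
      dist (zpowOrbit h x j) (g • zpowOrbit h x l) ≤ C →
      N ≤ dist (zpowOrbit h x i) (zpowOrbit h x j) →
      ∃ (u : Γ) (hu : IsLoxodromic X u), (u = h ∨ u = h⁻¹) ∧ ∃ a b : ℤ,
        (h ^ a * g * h ^ b) • endPair h hh ∈ (endPair u hu).nhd x r := by
  obtain ⟨δ, hδ⟩ := exists_isHyperbolicityConstant X
  obtain ⟨B, hB0, hB⟩ := hh.exists_isRuler x
  obtain ⟨L, hL⟩ := hh.exists_smul_endPair_mem_nhd x (C + 4 * (B + C + (C + 2 * B)) + 4 * δ) r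
  refine ⟨2 * L * dist x (h • x) + 2 * C + 1, fun g i j k l hik hjl hij => ?_⟩
  have hC : 0 ≤ C := dist_nonneg.trans hik
  wlog hkl : k ≤ l generalizing i j k l
  · exact this j i l k hjl hik (by rwa [dist_comm (zpowOrbit h x j)]) (by omega)
  obtain ⟨n, hn⟩ := Int.eq_ofNat_of_zero_le (sub_nonneg.2 hkl)
  obtain ⟨u, hu, huh, n', hn'⟩ : ∃ (u : Γ), ∃ _ : IsLoxodromic X u, (u = h ∨ u = h⁻¹) ∧
      ∃ n' : ℕ, h ^ (j - i) = u ^ n' := by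
    obtain ⟨n', hn' | hn'⟩ := (j - i).eq_nat_or_neg
    · exact ⟨h, hh, Or.inl rfl, n', by rw [hn', zpow_natCast]⟩
    · exact ⟨h⁻¹, hh.inv, Or.inr rfl, n', by rw [hn', ← inv_zpow', zpow_natCast]⟩
  set f := h ^ (-i) * g * h ^ k with hfdef
  have hf : dist x (f • x) ≤ C := by
    rw [← dist_smul (h ^ i), hfdef, mul_assoc, mul_smul, ← mul_smul (h ^ i), ← zpow_add]
    simpa [mul_smul, zpowOrbit] using hik
  have hf' : dist (u ^ n' • x) (f • h ^ n • x) ≤ C := by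
    rw [← hn', ← dist_smul (h ^ i), ← mul_smul, ← zpow_add, hfdef, mul_assoc, mul_smul,
      ← mul_smul (h ^ i), ← zpow_add, ← zpow_natCast h n, mul_smul g, ← mul_smul (h ^ k),
      ← zpow_add]
    have e : k + (n : ℤ) = l := by omega
    simpa [e, zpowOrbit] using hjl
  have e₁ : dist x (u ^ n' • x) = dist (zpowOrbit h x i) (zpowOrbit h x j) := by
    rw [← hn', ← dist_smul (h ^ i), ← mul_smul, ← zpow_add, add_sub_cancel]; rfl
  have e₂ : dist x (u ^ n' • x) ≤ dist x (h ^ n • x) + 2 * C := by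
    have h₁ := dist_triangle4 x (f • x) (f • h ^ n • x) (u ^ n' • x)
    rw [dist_smul, dist_comm (f • h ^ n • x)] at h₁
    linarith
  -- Both segments have at least `2 * L` steps, so there is room to recentre at the `L`-th one.
  have hlong : ∀ m : ℕ, 2 * L * dist x (h • x) < dist x (h ^ m • x) → 2 * L ≤ m := by
    intro m hm
    by_contra! hlt
    have h₁ := dist_pow_smul_le h x m
    have h₂ : (m : ℝ) ≤ 2 * L := by exact_mod_cast hlt.le
    have h₃ : 0 ≤ dist x (h • x) := dist_nonneg
    nlinarith
  have hn2 : 2 * L ≤ n := hlong n (by linarith)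
  have hn'2 : 2 * L ≤ n' := hlong n' (by
    rw [← dist_pow_smul_of_eq_or_eq_inv huh]; linarith)
  have hmid : (u ^ (-L : ℤ) * f * h ^ (L : ℤ)) • endPair h hh ∈ (endPair u hu).nhd x r := by
    refine hL u hu huh _ fun m hm => ?_
    have hm' := abs_le.1 hm
    have hLm : ((L + m).toNat : ℤ) = L + m := Int.toNat_of_nonneg (by omega)
    have h₁ := hB.dist_pow_smul_smul_pow_smul_le_of_endpoints hδ huh hf (m := (L + m).toNat)
      (n := n) (n' := n') (by omega) (by omega) hf'
    rw [← zpow_natCast, ← zpow_natCast, hLm] at h₁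
    rw [← dist_smul (u ^ (L : ℤ)), zpow_smul_zpowOrbit, mul_assoc, mul_smul, ← mul_smul (u ^ _),
      ← zpow_add, add_neg_cancel, zpow_zero, one_smul, mul_smul, zpow_smul_zpowOrbit]
    exact h₁
  obtain ⟨c, hc⟩ : ∃ c : ℤ, u ^ (-L : ℤ) = h ^ c := by
    rcases huh with rfl | rfl
    · exact ⟨_, rfl⟩
    · exact ⟨L, by rw [inv_zpow', neg_neg]⟩
  refine ⟨u, hu, huh, c - i, k + L, ?_⟩
  have e₃ : u ^ (-L : ℤ) * f * h ^ (L : ℤ) = h ^ (c - i) * g * h ^ (k + L) := by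
    rw [hc, hfdef, zpow_add h k, sub_eq_add_neg, zpow_add]
    simp only [mul_assoc]
  rwa [e₃] at hmid

end Orbit

/-! ### Discreteness of the orbits of end points -/

section Discrete

variable {Γ : Type*} [Group Γ] {X : Type*} [MetricSpace X] [MulAction Γ X]
  [IsIsometricSMul Γ X] [IsGromovHyperbolic X]

theorem attractingPoint_conj {h k : Γ} (hh : IsLoxodromic X h)
    (hk : IsLoxodromic X (k * h * k⁻¹)) :
    attractingPoint (k * h * k⁻¹) hk = k • attractingPoint h hh := by
  obtain ⟨x, -⟩ := id hh
  rw [attractingPoint_eq_boundaryPoint _ hk (k • x), attractingPoint_eq_boundaryPoint _ hh x,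
    smul_boundaryPoint]
  refine congrArg boundaryPoint (Subtype.ext (funext fun n => ?_))
  simp only [forwardOrbit, smulSeq, conj_pow, mul_smul, inv_smul_smul]

theorem repellingPoint_conj {h k : Γ} (hh : IsLoxodromic X h)
    (hk : IsLoxodromic X (k * h * k⁻¹)) :
    repellingPoint (k * h * k⁻¹) hk = k • repellingPoint h hh := by
  obtain ⟨x, -⟩ := id hh
  rw [repellingPoint_eq_boundaryPoint _ hk (k • x), repellingPoint_eq_boundaryPoint _ hh x,
    smul_boundaryPoint]
  refine congrArg boundaryPoint (Subtype.ext (funext fun n => ?_))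
  simp only [forwardOrbit, smulSeq, conj_inv, conj_pow, mul_smul, inv_smul_smul]

theorem endPair_conj {h k : Γ} (hh : IsLoxodromic X h) (hk : IsLoxodromic X (k * h * k⁻¹)) :
    endPair (k * h * k⁻¹) hk = k • endPair h hh :=
  Subtype.ext (Prod.ext (repellingPoint_conj hh hk) (attractingPoint_conj hh hk))

theorem smul_endPair_self (h : Γ) (hh : IsLoxodromic X h) : h • endPair h hh = endPair h hh := by
  have := endPair_conj (k := h) hh (by rwa [mul_inv_cancel_right])
  simp only [mul_inv_cancel_right] at this
  exact this.symm

theorem zpow_smul_endPair_self (h : Γ) (hh : IsLoxodromic X h) (n : ℤ) :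
    h ^ n • endPair h hh = endPair h hh :=
  (MulAction.stabilizer Γ (endPair h hh)).zpow_mem (smul_endPair_self h hh) n

theorem smul_endSet (g h : Γ) (hh : IsLoxodromic X h) :
    g • endSet h hh = (g • endPair h hh).toTwoSet :=
  smul_toTwoSet g _

theorem smul_endSet_eq_iff (g h : Γ) (hh : IsLoxodromic X h) :
    g • endSet h hh = endSet h hh ↔
      g • endPair h hh = endPair h hh ∨ g • endPair h hh = (endPair h hh).swap := by
  rw [smul_endSet, endSet, BoundaryPair.toTwoSet_eq_iff]

theorem zpow_smul_endSet_self (h : Γ) (hh : IsLoxodromic X h) (n : ℤ) :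
    h ^ n • endSet h hh = endSet h hh :=
  (smul_endSet_eq_iff _ _ _).2 (Or.inl (zpow_smul_endPair_self h hh n))

/-- By homogeneity, discreteness of the orbit of `∂_± h` need only be tested at `∂_± h`. -/
theorem wwpdDiscreteOrdered_iff {h : Γ} (hh : IsLoxodromic X h) (x : X) :
    WWPDDiscreteOrdered h hh ↔ ∃ r, ∀ g : Γ, g • endPair h hh ∈ (endPair h hh).nhd x r →
      g • endPair h hh = endPair h hh := by
  rw [WWPDDiscreteOrdered, isDiscrete_iff_forall_mem_exists_isOpen]
  constructor
  · intro H
    obtain ⟨U, hU, hUe⟩ := H _ (MulAction.mem_orbit_self _)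
    have he : endPair h hh ∈ U := (hUe.ge rfl).1
    obtain ⟨r, hr⟩ := (BoundaryPair.mem_nhds_iff x).1 (hU.mem_nhds he)
    exact ⟨r, fun g hg => hUe.le ⟨hr hg, MulAction.mem_orbit _ _⟩⟩
  · rintro ⟨r, hr⟩ _ ⟨g, rfl⟩
    refine ⟨interior ((g • endPair h hh).nhd (g • x) r), isOpen_interior,
      Set.Subset.antisymm ?_ (Set.singleton_subset_iff.2
        ⟨mem_interior_iff_mem_nhds.2 ((BoundaryPair.mem_nhds_iff (g • x)).2 ⟨r, subset_rfl⟩),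
          MulAction.mem_orbit _ _⟩)⟩
    rintro _ ⟨hq, g', rfl⟩
    have h₁ := smul_mem_nhd g⁻¹ (interior_subset hq)
    rw [inv_smul_smul, inv_smul_smul] at h₁
    have h₂ := hr (g⁻¹ * g') (by rwa [mul_smul])
    rw [mul_smul, inv_smul_eq_iff] at h₂
    exact h₂

theorem BoundaryPair.swap_mem_nhd_iff {x : X} {q q' : BoundaryPair X} {r : ℝ} :
    q'.swap ∈ q.nhd x r ↔ q' ∈ q.swap.nhd x r :=
  and_comm

/-- Discreteness of the orbit of `∂h` need only be tested at `∂h`, where the two orderings of the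
pair are the ends of `h` and of its inverse. -/
theorem wwpdDiscreteUnordered_iff {h : Γ} (hh : IsLoxodromic X h) (x : X) :
    WWPDDiscreteUnordered h hh ↔ ∃ r, ∀ (u : Γ) (hu : IsLoxodromic X u), (u = h ∨ u = h⁻¹) →
      ∀ g : Γ, g • endPair h hh ∈ (endPair u hu).nhd x r → g • endSet h hh = endSet h hh := by
  rw [WWPDDiscreteUnordered, isDiscrete_iff_forall_mem_exists_isOpen]
  constructor
  · intro H
    obtain ⟨U, hU, hUe⟩ := H _ (MulAction.mem_orbit_self _)
    have he : endSet h hh ∈ U := (hUe.ge rfl).1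
    have hV : IsOpen (BoundaryPair.toTwoSet ⁻¹' U) := hU.preimage continuous_coinduced_rng
    have he' : (endPair h hh).swap.toTwoSet ∈ U := by
      rwa [BoundaryPair.toTwoSet_eq_iff.2 (Or.inr rfl)]
    obtain ⟨r, hr⟩ := (BoundaryPair.mem_nhds_iff x).1 (hV.mem_nhds he)
    obtain ⟨s, hs⟩ := (BoundaryPair.mem_nhds_iff x).1 (hV.mem_nhds he')
    refine ⟨max r s, fun u hu huh g hg => hUe.le ⟨?_, MulAction.mem_orbit _ _⟩⟩
    rw [smul_endSet]
    rcases huh with rfl | rfl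
    · exact hr (BoundaryPair.nhd_anti _ _ (le_max_left r s) hg)
    · rw [endPair_inv _ hh] at hg
      exact hs (BoundaryPair.nhd_anti _ _ (le_max_right r s) hg)
  · rintro ⟨r, hr⟩ _ ⟨g, rfl⟩
    refine ⟨BoundaryPair.toTwoSet '' interior ((g • endPair h hh).nhd (g • x) r),
      BoundaryPair.isOpenMap_toTwoSet _ isOpen_interior,
      Set.Subset.antisymm ?_ (Set.singleton_subset_iff.2
        ⟨⟨_, mem_interior_iff_mem_nhds.2 ((BoundaryPair.mem_nhds_iff (g • x)).2 ⟨r, subset_rfl⟩),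
          (smul_endSet _ _ _).symm⟩, MulAction.mem_orbit _ _⟩)⟩
    rintro _ ⟨⟨q, hq, hqz⟩, g', rfl⟩
    have h₁ := smul_mem_nhd g⁻¹ (interior_subset hq)
    rw [inv_smul_smul, inv_smul_smul] at h₁
    change q.toTwoSet = g' • endSet h hh at hqz
    change g' • endSet h hh = g • endSet h hh
    rw [smul_endSet g', BoundaryPair.toTwoSet_eq_iff] at hqz
    have h₂ : (g⁻¹ * g') • endSet h hh = endSet h hh := by
      rcases hqz with rfl | rfl
      · exact hr h hh (Or.inl rfl) _ (by rwa [mul_smul])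
      · refine hr h⁻¹ hh.inv (Or.inr rfl) _ ?_
        rwa [smul_swap, BoundaryPair.swap_mem_nhd_iff, ← endPair_inv, ← mul_smul] at h₁
    rwa [mul_smul, inv_smul_eq_iff] at h₂

end Discrete

/-! ### Sequences of almost stationary elements -/

section Sequences

variable {Γ : Type*} [Group Γ] {X : Type*} [MetricSpace X] [MulAction Γ X]
  [IsIsometricSMul Γ X] [IsGromovHyperbolic X]

theorem inv_mul_mem_stabilizer_iff {α : Type*} [MulAction Γ α] {g k : Γ} {a : α} :
    g⁻¹ * k ∈ MulAction.stabilizer Γ a ↔ k • a = g • a := by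
  rw [MulAction.mem_stabilizer_iff, mul_smul, inv_smul_eq_iff]

/-- A bad sequence can be built one element at a time. -/
theorem exists_pairwiseDifferentCosets_eventuallyUnmoved {h : Γ} (hh : IsLoxodromic X h) {x : X}
    {C : ℝ} (H : ∀ (s : Finset Γ) (M : ℕ), ∃ g : Γ, (∀ k ∈ s, g • endPair h hh ≠ k • endPair h hh) ∧
      ∀ m ≤ M, dist (h ^ m • x) (g • h ^ m • x) ≤ C) :
    ∃ g : ℕ → Γ, PairwiseDifferentCosets h hh g ∧ ∀ y : X, EventuallyUnmoved h g y := by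
  classical
  obtain ⟨f, hf, hf'⟩ := exists_seq_of_forall_finset_exists
    (fun a : Γ × ℕ => ∀ m ≤ a.2, dist (h ^ m • x) (a.1 • h ^ m • x) ≤ C)
    (fun a b => a.2 < b.2 ∧ b.1 • endPair h hh ≠ a.1 • endPair h hh) (by
      intro s _
      obtain ⟨g, hg, hgM⟩ := H (s.image Prod.fst) (s.sup Prod.snd + 1)
      exact ⟨(g, s.sup Prod.snd + 1), hgM, fun a ha =>
        ⟨Nat.lt_succ_of_le (Finset.le_sup (f := Prod.snd) ha),
          hg a.1 (Finset.mem_image_of_mem _ ha)⟩⟩)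
  have hmono : StrictMono fun n => (f n).2 := fun m n hmn => (hf' m n hmn).1
  refine ⟨fun n => (f n).1, fun i j hij => ?_, fun y => ⟨max C 0 + 2 * dist x y + 1, ?_, ?_⟩⟩
  · rw [inv_mul_mem_stabilizer_iff]
    rcases hij.lt_or_gt with hij | hij
    · exact (hf' i j hij).2
    · exact (hf' j i hij).2.symm
  · positivity
  · intro M
    refine ⟨M, fun m i hm hi => ?_⟩
    have h₁ := hf i m (hm.trans (hi.trans (hmono.id_le i)))
    have h₂ := dist_triangle4 ((f i).1 • h ^ m • y) ((f i).1 • h ^ m • x) (h ^ m • x) (h ^ m • y)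
    rw [dist_smul, dist_smul, dist_smul, dist_comm y x,
      dist_comm ((f i).1 • h ^ m • x)] at h₂
    linarith [le_max_left C 0]

theorem WWPDAcylindrical.noBadSequenceExists {h : Γ} {hh : IsLoxodromic X h}
    (H : WWPDAcylindrical h hh) : WWPDNoBadSequenceExists h hh := by
  rintro ⟨g, hg, x, R, hR, hx⟩
  obtain ⟨M, -, hM⟩ := H x R hR
  obtain ⟨I, hI⟩ := hx M
  have hinj : Function.Injective fun i => g (I + i) := by
    intro i j hij
    by_contra hne
    refine hg (I + i) (I + j) (by omega) ?_
    simp only at hij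
    rw [hij, inv_mul_cancel]
    exact one_mem _
  refine Set.infinite_range_of_injective hinj (hM _ ?_ ?_)
  · rintro _ ⟨i, rfl⟩
    constructor
    · have := hI 0 (I + i) (Nat.zero_le _) (Nat.le_add_right _ _)
      rwa [pow_zero, one_smul, dist_comm] at this
    · rw [dist_comm]
      exact hI M (I + i) le_rfl (Nat.le_add_right _ _)
  · rintro _ ⟨i, rfl⟩ _ ⟨j, rfl⟩ hne
    exact hg _ _ fun e => hne (congrArg g e)

theorem WWPDNoBadSequenceExists.noBadSequenceForall {h : Γ} {hh : IsLoxodromic X h}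
    (H : WWPDNoBadSequenceExists h hh) : WWPDNoBadSequenceForall h hh := by
  rintro ⟨g, hg, hx⟩
  obtain ⟨x, -⟩ := id hh
  exact H ⟨g, hg, x, hx x⟩

theorem WWPDNoBadSequenceForall.acylindrical {h : Γ} {hh : IsLoxodromic X h}
    (H : WWPDNoBadSequenceForall h hh) : WWPDAcylindrical h hh := by
  intro x R hR
  by_contra! hcon
  obtain ⟨δ, hδ⟩ := exists_isHyperbolicityConstant X
  obtain ⟨B, -, hB⟩ := hh.exists_isRuler x
  refine H (exists_pairwiseDifferentCosets_eventuallyUnmoved hh (x := x)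
    (C := R + 4 * (B + R + (R + 2 * B)) + 4 * δ) fun s M => ?_)
  obtain ⟨Z, hZ, hZ', hZinf⟩ := hcon (M + 1) (by omega)
  -- Each element of `s` shares its coset with at most one element of the infinite set `Z`.
  obtain ⟨g, hgZ, hg⟩ : ∃ g ∈ Z, ∀ k ∈ s, g • endPair h hh ≠ k • endPair h hh := by
    by_contra! hall
    choose! c hcs hc using hall
    obtain ⟨g, hg, k, hk, hne, hgk⟩ :=
      Set.Infinite.exists_ne_map_eq_of_mapsTo hZinf hcs s.finite_toSet
    refine hZ' g hg k hk hne ?_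
    rw [inv_mul_mem_stabilizer_iff, hc g hg, hc k hk, hgk]
  exact ⟨g, hg, fun m hm => hB.dist_pow_smul_smul_pow_smul_le_of_endpoints hδ (Or.inl rfl)
    (hZ g hgZ).1.le (n := M + 1) (n' := M + 1) (by omega) (by omega) (hZ g hgZ).2.le⟩

theorem WWPDNoBadSequenceForall.discreteOrdered {h : Γ} {hh : IsLoxodromic X h}
    (H : WWPDNoBadSequenceForall h hh) : WWPDDiscreteOrdered h hh := by
  obtain ⟨x, -⟩ := id hh
  rw [wwpdDiscreteOrdered_iff hh x]
  by_contra! hcon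
  obtain ⟨C, hC⟩ := hh.exists_dist_zpowOrbit_le x
  refine H (exists_pairwiseDifferentCosets_eventuallyUnmoved hh (x := x) (C := C) fun s M => ?_)
  obtain ⟨r₀, hr₀⟩ := hC M
  have hρ : ∀ k : Γ, ∃ ρ, k • endPair h hh ≠ endPair h hh →
      k • endPair h hh ∉ (endPair h hh).nhd x ρ := by
    intro k
    by_contra! hk
    exact (hk 0).1 (BoundaryPair.eq_of_forall_mem_nhd fun r => (hk r).2)
  choose ρ hρ using hρ
  obtain ⟨r₁, hr₁⟩ := (s.image ρ).exists_le
  obtain ⟨g, hg, hne⟩ := hcon (max r₀ r₁)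
  obtain ⟨k, hk⟩ := hr₀ h hh (Or.inl rfl) g (BoundaryPair.nhd_anti _ _ (le_max_left r₀ r₁) hg)
  refine ⟨g * h ^ k, fun a ha e => ?_, fun m hm => ?_⟩
  · rw [mul_smul, zpow_smul_endPair_self] at e
    refine hρ a (e ▸ hne) (e ▸ BoundaryPair.nhd_anti _ _ ?_ hg)
    exact (hr₁ _ (Finset.mem_image_of_mem _ ha)).trans (le_max_right _ _)
  · have := hk m (by simpa using hm)
    rwa [zpowOrbit_natCast] at this

/-- If translates of `∂_± h` accumulated at `∂_± h` with its orientation reversed, then products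
`g⁻¹ * g'` of the elements involved would carry `∂_± h` close to itself. -/
theorem WWPDDiscreteOrdered.discreteUnordered {h : Γ} {hh : IsLoxodromic X h}
    (H : WWPDDiscreteOrdered h hh) : WWPDDiscreteUnordered h hh := by
  obtain ⟨x, -⟩ := id hh
  obtain ⟨r₀, hr₀⟩ := (wwpdDiscreteOrdered_iff hh x).1 H
  rw [wwpdDiscreteUnordered_iff hh x]
  obtain ⟨C, hC⟩ := hh.exists_dist_zpowOrbit_le x
  obtain ⟨L, hL⟩ := hh.exists_smul_endPair_mem_nhd x (2 * C) r₀
  obtain ⟨r₁, hr₁⟩ := hC L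
  by_contra! hcon
  have hrev : ∀ r, r₀ ≤ r → ∃ g : Γ, g • endPair h hh ∈ (endPair h⁻¹ hh.inv).nhd x r ∧
      g • endSet h hh ≠ endSet h hh := by
    intro r hr
    obtain ⟨u, hu, rfl | rfl, g, hg, hne⟩ := hcon r
    · have := hr₀ g (BoundaryPair.nhd_anti _ _ hr hg)
      exact absurd ((smul_endSet_eq_iff _ _ _).2 (Or.inl this)) hne
    · exact ⟨g, hg, hne⟩
  obtain ⟨g, hg, hne⟩ := hrev (max r₀ r₁) (le_max_left _ _)
  obtain ⟨k, hk⟩ := hr₁ _ hh.inv (Or.inr rfl) g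
    (BoundaryPair.nhd_anti _ _ (le_max_right r₀ r₁) hg)
  -- All reversing elements agree with `g` on the ends of `h`, so `g` reverses them exactly.
  have hlim : ∀ r, g • endPair h hh ∈ (endPair h⁻¹ hh.inv).nhd x r := by
    intro r
    obtain ⟨g', hg', -⟩ := hrev (max r (max r₀ r₁)) (by simp)
    obtain ⟨k', hk'⟩ := hr₁ _ hh.inv (Or.inr rfl) g'
      (BoundaryPair.nhd_anti _ _ ((le_max_right r₀ r₁).trans (le_max_right _ _)) hg')
    have h₁ := hr₀ ((g * h ^ k)⁻¹ * (g' * h ^ k'))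
      (hL h hh (Or.inl rfl) _ fun m hm => ?_)
    · rw [mul_smul, inv_smul_eq_iff, mul_smul, mul_smul, zpow_smul_endPair_self,
        zpow_smul_endPair_self] at h₁
      rw [← h₁]
      exact BoundaryPair.nhd_anti _ _ (le_max_left _ _) hg'
    · rw [← dist_smul (g * h ^ k), ← mul_smul, mul_inv_cancel_left]
      have h₂ := dist_triangle_left ((g * h ^ k) • zpowOrbit h x m)
        ((g' * h ^ k') • zpowOrbit h x m) (zpowOrbit h⁻¹ x m)
      linarith [hk m hm, hk' m hm]
  have := BoundaryPair.eq_of_forall_mem_nhd hlim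
  rw [endPair_inv _ hh] at this
  exact hne ((smul_endSet_eq_iff _ _ _).2 (Or.inr this))

end Sequences

/-! ### Quasi-axes and closest point projections -/

section QuasiAxis

variable {Γ : Type*} [Group Γ] {X : Type*} [MulAction Γ X]

theorem zpow_smul_eq_of_smul_eq {h : Γ} {l : ℝ → X} {T : ℝ} (hl : ∀ t, h • l t = l (t + T))
    (n : ℤ) (t : ℝ) : h ^ n • l t = l (t + n * T) := by
  have hnat : ∀ (n : ℕ) (t : ℝ), h ^ n • l t = l (t + n * T) := by
    intro n
    induction n with
    | zero => simp
    | succ n ih =>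
      intro t
      rw [pow_succ, mul_smul, hl, ih]
      push_cast
      congr 1; ring
  obtain ⟨n, rfl | rfl⟩ := n.eq_nat_or_neg
  · rw [zpow_natCast, hnat, Int.cast_natCast]
  · rw [zpow_neg, inv_smul_eq_iff, zpow_natCast, hnat]
    push_cast
    congr 1; ring

variable [MetricSpace X]

theorem IsQuasiIsometricEmbedding.exists_closest {l : ℝ → X} (hl : IsQuasiIsometricEmbedding l)
    (hc : Continuous l) (a : X) : ∃ t, ∀ s, dist a (l t) ≤ dist a (l s) := by
  obtain ⟨K, c, hK, -, H⟩ := hl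
  refine (continuous_const.dist hc).exists_forall_le ?_
  have h₁ : Tendsto (fun t : ℝ => ‖t‖ / K - (c + dist a (l 0))) (cocompact ℝ) atTop :=
    tendsto_atTop_add_const_right _ _
      (tendsto_norm_cocompact_atTop.atTop_div_const (by linarith))
  refine tendsto_atTop_mono (fun t => ?_) h₁
  have h₂ := (H 0 t).1
  have h₃ := dist_triangle_left (l 0) (l t) a
  rw [dist_zero_left] at h₂
  linarith

theorem IsQuasiAxis.exists_isClosestPointMap {h : Γ} {l : ℝ → X} (hl : IsQuasiAxis h l)
    (A : Set X) : ∃ π : A → (Set.range l : Set X), IsClosestPointMap π := by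
  choose t ht using hl.2.1.exists_closest hl.1
  refine ⟨fun a => ⟨l (t a), t a, rfl⟩, ?_⟩
  rintro a ⟨_, s, rfl⟩
  exact ht a s

variable [IsIsometricSMul Γ X]

/-- Translates of a geodesic from `x` to `h • x` form a quasi-axis. -/
theorem IsLoxodromic.exists_isQuasiAxis (hX : IsGeodesicSpace X) {h : Γ}
    (hh : IsLoxodromic X h) : ∃ l : ℝ → X, IsQuasiAxis h l := by
  obtain ⟨x, K, C, hK, hC, H⟩ := id hh
  obtain ⟨c, hc0, hc1, hc⟩ := hX x (h • x)
  set d := dist x (h • x) with hd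
  have hd0 : 0 ≤ d := dist_nonneg
  have hK0 : 0 < K := by linarith
  set l : ℝ → X := fun t => h ^ ⌊t⌋ • c (Int.fract t * d) with hl
  have hfract : ∀ t : ℝ, Int.fract t * d ∈ Set.Icc 0 d := fun t =>
    ⟨mul_nonneg (Int.fract_nonneg t) hd0,
      mul_le_of_le_one_left hd0 (Int.fract_lt_one t).le⟩
  have hleft : ∀ t : ℝ, dist (h ^ ⌊t⌋ • x) (l t) = Int.fract t * d := by
    intro t
    rw [hl, dist_smul]
    nth_rewrite 1 [← hc0]
    rw [hc 0 ⟨le_rfl, hd0⟩ _ (hfract t), zero_sub, abs_neg, abs_of_nonneg (hfract t).1]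
  have hright : ∀ t : ℝ, dist (l t) (h ^ (⌊t⌋ + 1) • x) = (1 - Int.fract t) * d := by
    intro t
    rw [zpow_add_one, mul_smul, hl, dist_smul]
    nth_rewrite 1 [← hc1]
    rw [hc _ (hfract t) d ⟨hd0, le_rfl⟩, abs_sub_comm, abs_of_nonneg (by linarith [(hfract t).2])]
    ring
  have hpow : ∀ (m : ℤ) (n : ℕ), dist (h ^ m • x) (h ^ (m + n) • x) ≤ n * d := by
    intro m n
    rw [zpow_add, mul_smul, dist_smul, zpow_natCast]
    exact dist_pow_smul_le h x n
  have hlip' : ∀ s t, s ≤ t → dist (l s) (l t) ≤ d * (t - s) := by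
    intro s t hst
    have hs := Int.floor_add_fract s
    have ht := Int.floor_add_fract t
    rcases (Int.floor_mono hst).eq_or_lt with h₁ | h₁
    · change dist (h ^ ⌊s⌋ • c _) (h ^ ⌊t⌋ • c _) ≤ _
      rw [h₁, dist_smul, hc _ (hfract s) _ (hfract t), abs_sub_comm, ← sub_mul,
        abs_of_nonneg]
      · rw [h₁] at hs
        have : Int.fract t - Int.fract s = t - s := by linarith
        rw [this, mul_comm]
      · rw [h₁] at hs
        exact mul_nonneg (by linarith) hd0
    · obtain ⟨n, hn⟩ := Int.eq_ofNat_of_zero_le (sub_nonneg.2 (Int.add_one_le_iff.2 h₁))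
      have hn' : ⌊t⌋ = ⌊s⌋ + 1 + n := by omega
      have h₂ := dist_triangle4 (l s) (h ^ (⌊s⌋ + 1) • x) (h ^ ⌊t⌋ • x) (l t)
      rw [hright, hleft] at h₂
      have h₃ := hpow (⌊s⌋ + 1) n
      rw [← hn'] at h₃
      have h₄ : ((⌊t⌋ : ℤ) : ℝ) = ⌊s⌋ + 1 + n := by exact_mod_cast hn'
      have h₅ : t - s = (1 - Int.fract s) + n + Int.fract t := by linarith
      rw [h₅]
      linarith
  have hlip : ∀ s t, dist (l s) (l t) ≤ d * dist s t := by
    intro s t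
    rcases le_total s t with hst | hst
    · rw [dist_comm s t, Real.dist_eq, abs_of_nonneg (sub_nonneg.2 hst)]
      exact hlip' s t hst
    · rw [dist_comm (l s), Real.dist_eq, abs_of_nonneg (sub_nonneg.2 hst)]
      exact hlip' t s hst
  refine ⟨l, ?_, ⟨max K d, C + 2 * d + 2, hK.trans (le_max_left _ _), by linarith,
    fun s t => ⟨?_, ?_⟩⟩, 1, one_pos, fun t => ?_⟩
  · exact (LipschitzWith.of_dist_le_mul (K := ⟨d, hd0⟩) hlip).continuous
  · have h₁ := (H ⌊s⌋ ⌊t⌋).1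
    have h₂ := dist_triangle4 (h ^ ⌊s⌋ • x) (l s) (l t) (h ^ ⌊t⌋ • x)
    rw [hleft, dist_comm (l t), hleft] at h₂
    have h₃ := (hfract s).2
    have h₄ := (hfract t).2
    have h₅ : dist s t - 2 ≤ dist ⌊s⌋ ⌊t⌋ := by
      rw [Int.dist_eq, Real.dist_eq]
      have h₆ : s - t = ((⌊s⌋ : ℝ) - ⌊t⌋) + (Int.fract s - Int.fract t) := by
        linarith [Int.floor_add_fract s, Int.floor_add_fract t]
      have h₇ : |Int.fract s - Int.fract t| ≤ 1 :=
        abs_le.2 ⟨by linarith [Int.fract_nonneg s, Int.fract_lt_one t],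
          by linarith [Int.fract_nonneg t, Int.fract_lt_one s]⟩
      have h₈ := abs_add_le ((⌊s⌋ : ℝ) - ⌊t⌋) (Int.fract s - Int.fract t)
      rw [h₆]
      linarith
    have h₆ : dist s t / max K d ≤ dist s t / K :=
      div_le_div_of_nonneg_left dist_nonneg hK0 (le_max_left _ _)
    have h₇ : dist s t / K - 2 ≤ dist ⌊s⌋ ⌊t⌋ / K := by
      have h₈ : (dist s t - 2) / K ≤ dist ⌊s⌋ ⌊t⌋ / K := by gcongr
      have h₉ : 2 / K ≤ 2 := div_le_self (by norm_num) hK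
      rw [sub_div] at h₈
      linarith
    linarith
  · have h₁ := hlip s t
    have h₂ : d * dist s t ≤ max K d * dist s t :=
      mul_le_mul_of_nonneg_right (le_max_right _ _) dist_nonneg
    linarith
  · rw [hl]
    simp only [Int.floor_add_one, Int.fract_add_one]
    rw [add_comm, zpow_one_add, mul_smul]

variable [IsGromovHyperbolic X]

open scoped Pointwise in
/-- A long projection of a translate of the quasi-axis to the quasi-axis forces the two to be close
to each other at two places far apart. -/
theorem WWPDDiscreteUnordered.boundedProjections {h : Γ} {hh : IsLoxodromic X h}
    (H : WWPDDiscreteUnordered h hh) : WWPDBoundedProjections h hh := by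
  rintro l ⟨-, ⟨K, c, hK, hc, hqi⟩, T, hT, hlT⟩
  set x := l 0 with hx
  obtain ⟨r, hr⟩ := (wwpdDiscreteUnordered_iff hh x).1 H
  obtain ⟨δ, hδ⟩ := exists_isHyperbolicityConstant X
  obtain ⟨B, hB0, hB⟩ := hh.exists_isRuler x
  set C₀ := K * T + c with hC₀
  have hC₀' : 0 ≤ C₀ := by positivity
  have horb : ∀ n : ℤ, zpowOrbit h x n = l (n * T) := by
    intro n
    rw [zpowOrbit, hx, zpow_smul_eq_of_smul_eq hlT, zero_add]
  have hnear : ∀ t, ∃ n : ℤ, dist (l t) (zpowOrbit h x n) ≤ C₀ := by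
    intro t
    refine ⟨⌊t / T⌋, ?_⟩
    rw [horb]
    have h₁ : dist t (⌊t / T⌋ * T) ≤ T := by
      have h₂ : t - ⌊t / T⌋ * T = Int.fract (t / T) * T := by
        rw [← Int.self_sub_floor, sub_mul, div_mul_cancel₀ _ hT.ne']
      rw [Real.dist_eq, h₂, abs_of_nonneg (mul_nonneg (Int.fract_nonneg _) hT.le)]
      exact mul_le_of_le_one_left hT.le (Int.fract_lt_one _).le
    have h₂ := (hqi t (⌊t / T⌋ * T)).2
    have h₃ : K * dist t (⌊t / T⌋ * T) ≤ K * T := mul_le_mul_of_nonneg_left h₁ (by linarith)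
    linarith
  set C₁ := 3 * C₀ + 4 * B + 2 * δ with hC₁
  set C₂ := 5 * B + 6 * (C₁ + δ) + 4 * δ with hC₂
  obtain ⟨N, hN⟩ := hh.exists_smul_endPair_mem_nhd_of_dist_le x C₂ r
  set D := max 0 (max N (2 * C₁ + δ + 1)) + 2 * C₀ with hD
  refine ⟨D, by positivity, fun g hg π hπ a b => ?_⟩
  by_contra! hab
  -- A point of the translate and its closest point are replaced by orbit points.
  have hfoot : ∀ a : (g • Set.range l : Set X), ∃ i k : ℤ,
      dist (π a : X) (zpowOrbit h x i) ≤ C₀ ∧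
      ∀ n, dist (g • zpowOrbit h x k) (zpowOrbit h x i) ≤
        dist (g • zpowOrbit h x k) (zpowOrbit h x n) + 3 * C₀ := by
    rintro ⟨_, _, ⟨s, rfl⟩, rfl⟩
    set a : (g • Set.range l : Set X) := ⟨g • l s, _, ⟨s, rfl⟩, rfl⟩
    obtain ⟨t, ht⟩ : (π a : X) ∈ Set.range l := (π a).2
    obtain ⟨i, hi⟩ := hnear t
    obtain ⟨k, hk⟩ := hnear s
    rw [ht] at hi
    refine ⟨i, k, hi, fun n => ?_⟩
    have h₁ : dist (g • l s) (π a : X) ≤ dist (g • l s) (zpowOrbit h x n) :=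
      hπ a ⟨zpowOrbit h x n, n * T, (horb n).symm⟩
    have h₂ := dist_triangle4 (g • zpowOrbit h x k) (g • l s) (π a : X) (zpowOrbit h x i)
    have h₃ := dist_triangle (g • l s) (g • zpowOrbit h x k) (zpowOrbit h x n)
    rw [dist_smul] at h₂ h₃
    rw [dist_comm] at hk
    rw [dist_comm (l s)] at h₃
    linarith
  obtain ⟨i, k, hai, hak⟩ := hfoot a
  obtain ⟨j, m, hbj, hbm⟩ := hfoot b
  set P := zpowOrbit h x i
  set Q := zpowOrbit h x j
  have hPQ : max 0 (max N (2 * C₁ + δ + 1)) ≤ dist P Q := by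
    have h₁ := dist_triangle4 (π a : X) P Q (π b : X)
    rw [dist_comm Q] at h₁
    linarith
  have hPQ₁ : N ≤ dist P Q := ((le_max_left _ _).trans (le_max_right _ _)).trans hPQ
  have hPQ₂ : 2 * C₁ + δ + 1 ≤ dist P Q := ((le_max_right _ _).trans (le_max_right _ _)).trans hPQ
  have hP := hB.gromovProduct_le_of_closest hδ hB0 hak j
  have hQ := hB.gromovProduct_le_of_closest hδ hB0 hbm i
  -- With perpendicular feet `p` and `q` far apart, a coarse geodesic from `y` to `z` passes by `p`.
  have key : ∀ {p q y z : X}, 2 * C₁ + δ + 1 ≤ dist p q → gromovProduct p y q ≤ C₁ →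
      gromovProduct q z p ≤ C₁ → gromovProduct p y z ≤ C₁ + δ := by
    intro p q y z hpq h₁ h₂
    by_contra! hcon
    have h₃ := gromovProduct_add_gromovProduct p q z
    rw [gromovProduct_comm q p z] at h₃
    have h₄ := hδ.le_gromovProduct (a := min (gromovProduct p y z) (C₁ + δ + 1)) (x := y) (y := z)
      (z := q) (p := p) (min_le_left _ _) ((min_le_right _ _).trans (by
        rw [gromovProduct_comm]; linarith))
    rcases min_choice (gromovProduct p y z) (C₁ + δ + 1) with h₅ | h₅ <;> rw [h₅] at h₄ <;>
      linarith
  have hgclose : ∀ p, gromovProduct p (g • zpowOrbit h x k) (g • zpowOrbit h x m) ≤ C₁ + δ →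
      ∃ n, dist p (g • zpowOrbit h x n) ≤ C₂ := by
    intro p hp
    rw [← smul_inv_smul g p, gromovProduct_smul] at hp
    obtain ⟨n, hn⟩ := hB.exists_dist_le hδ hB0 hp
    refine ⟨n, ?_⟩
    rwa [← dist_smul g, smul_inv_smul] at hn
  obtain ⟨k', hk'⟩ := hgclose P (key hPQ₂ hP hQ)
  obtain ⟨m', hm'⟩ := hgclose Q (by
    rw [gromovProduct_comm]
    exact key (by rwa [dist_comm]) hQ hP)
  obtain ⟨u, hu, huh, e, e', he⟩ := hN g i j k' m' hk' hm' hPQ₁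
  have h₁ := hr u hu huh _ he
  rw [mul_assoc, mul_smul, mul_smul, zpow_smul_endSet_self, ← eq_inv_smul_iff, ← zpow_neg,
    zpow_smul_endSet_self] at h₁
  exact hg h₁

open scoped Pointwise in
/-- A translate of the quasi-axis by an element that moves a long segment of it a bounded amount
has a long projection. -/
theorem WWPDBoundedProjections.noBadSequenceForall (hX : IsGeodesicSpace X) {h : Γ}
    {hh : IsLoxodromic X h} (H : WWPDBoundedProjections h hh) :
    WWPDNoBadSequenceForall h hh := by
  rintro ⟨g, hg, hx⟩
  obtain ⟨l, hl⟩ := hh.exists_isQuasiAxis hX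
  obtain ⟨D, -, hD⟩ := H l hl
  obtain ⟨T, -, hlT⟩ := hl.2.2
  obtain ⟨R, -, hR⟩ := hx (l 0)
  obtain ⟨L, hL⟩ := hh.exists_le_dist (l 0) (D + 4 * R)
  obtain ⟨I, hI⟩ := hR L
  -- The group `Stab(∂h)` contains at most two cosets of `Stab(∂_± h)`.
  obtain ⟨i, hiI, hi⟩ : ∃ i, I ≤ i ∧ g i ∉ MulAction.stabilizer Γ (endSet h hh) := by
    by_contra! hcon
    have h₁ := fun i (hi : I ≤ i) => (smul_endSet_eq_iff (g i) h hh).1 (hcon i hi)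
    have h₂ : ∀ i j, i ≠ j → g j • endPair h hh ≠ g i • endPair h hh := fun i j hij e =>
      hg i j hij (inv_mul_mem_stabilizer_iff.2 e)
    have h₃ := h₂ I (I + 1) (by omega)
    have h₄ := h₂ I (I + 2) (by omega)
    have h₅ := h₂ (I + 1) (I + 2) (by omega)
    rcases h₁ I le_rfl with e₁ | e₁ <;> rcases h₁ (I + 1) (by omega) with e₂ | e₂ <;>
      rcases h₁ (I + 2) (by omega) with e₃ | e₃ <;> simp_all
  obtain ⟨π, hπ⟩ := hl.exists_isClosestPointMap (g i • Set.range l)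
  have horb : ∀ m : ℕ, h ^ m • l 0 ∈ Set.range l := fun m => by
    rw [← zpow_natCast, zpow_smul_eq_of_smul_eq hlT]
    exact ⟨_, rfl⟩
  have hmove : ∀ m, (hm : m ≤ L) →
      dist (h ^ m • l 0) (π ⟨g i • h ^ m • l 0, Set.smul_mem_smul_set (horb m)⟩ : X) < 2 * R := by
    intro m hm
    have h₁ := hI m i hm hiI
    have h₂ := hπ ⟨g i • h ^ m • l 0, Set.smul_mem_smul_set (horb m)⟩ ⟨_, horb m⟩
    have h₃ := dist_triangle_left (h ^ m • l 0)
      (π ⟨g i • h ^ m • l 0, Set.smul_mem_smul_set (horb m)⟩ : X) (g i • h ^ m • l 0)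
    simp only at h₂
    linarith
  have h₁ := hD (g i) hi π hπ ⟨_, Set.smul_mem_smul_set (horb 0)⟩
    ⟨_, Set.smul_mem_smul_set (horb L)⟩
  have h₂ := hmove 0 (Nat.zero_le _)
  have h₃ := hmove L le_rfl
  have h₄ := dist_triangle4 (h ^ 0 • l 0)
    (π ⟨g i • h ^ 0 • l 0, Set.smul_mem_smul_set (horb 0)⟩ : X)
    (π ⟨g i • h ^ L • l 0, Set.smul_mem_smul_set (horb L)⟩ : X) (h ^ L • l 0)
  rw [dist_comm (π ⟨g i • h ^ L • l 0, _⟩ : X) (h ^ L • l 0)] at h₄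
  have h₅ : D + 4 * R ≤ dist (h ^ 0 • l 0) (h ^ L • l 0) := by
    rw [pow_zero, one_smul]
    exact hL L le_rfl
  linarith

end QuasiAxis

/-! ### North-south dynamics and shared end points -/

section NorthSouth

variable {Γ : Type*} [Group Γ] {X : Type*} [MetricSpace X] [MulAction Γ X]
  [IsIsometricSMul Γ X] [IsGromovHyperbolic X]

/-- Backward iterates of a boundary point other than the attracting one approach the repelling
point. -/
theorem IsLoxodromic.exists_inv_pow_smul_mem_boundaryNhd {h : Γ} (hh : IsLoxodromic X h) (x : X)
    {ξ : GromovBoundary X} (hξ : ξ ≠ attractingPoint h hh) (r : ℝ) :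
    ∃ i : ℕ, h⁻¹ ^ i • ξ ∈ boundaryNhd x (repellingPoint h hh) r := by
  obtain ⟨δ, hδ⟩ := exists_isHyperbolicityConstant X
  obtain ⟨B, hB0, hB⟩ := hh.exists_isRuler x
  obtain ⟨y, rfl⟩ := exists_boundaryPoint_eq ξ
  rw [attractingPoint_eq_boundaryPoint h hh x, ne_comm, Ne, boundaryPoint_eq_iff] at hξ
  obtain ⟨E, N, hE⟩ := exists_gromovProduct_le_of_not_seqAsymptotic (forwardOrbit hh x).2 y.2 hξ x
  obtain ⟨L, hL⟩ := hh.exists_le_dist x (r + |E| + B + δ)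
  set i := max L N
  have hLi := hL i (le_max_left _ _)
  have hE0 := le_abs_self E
  have hE1 := abs_nonneg E
  refine ⟨i, ?_⟩
  rw [repellingPoint_eq_boundaryPoint h hh x, smul_boundaryPoint]
  refine mem_boundaryNhd_of_le i fun m n hm hn => ?_
  have h₁ := gromovProduct_add_gromovProduct x (h⁻¹ ^ i • x) (h⁻¹ ^ m • x)
  have h₂ := hB.zpowOrbit_inv.gromovProduct_pow_smul_le hm
  have h₃ := gromovProduct_add_gromovProduct x (h⁻¹ ^ i • x) (h⁻¹ ^ i • y.1 n)
  have h₄ : gromovProduct (h⁻¹ ^ i • x) x (h⁻¹ ^ i • y.1 n) ≤ E := by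
    rw [← gromovProduct_smul (h ^ i), inv_pow, smul_inv_smul, smul_inv_smul]
    exact hE i n (le_max_right _ _) ((le_max_right _ _).trans hn)
  rw [dist_inv_pow_smul] at h₁ h₃
  have h₅ := hδ.le_gromovProduct (p := x) (x := h⁻¹ ^ m • x) (y := h⁻¹ ^ i • x)
    (z := h⁻¹ ^ i • y.1 n) (a := r + δ) (by rw [gromovProduct_comm]; linarith) (by linarith)
  simpa [forwardOrbit, smulSeq] using h₅

theorem WWPDDiscreteOrdered.inv {h : Γ} {hh : IsLoxodromic X h} (H : WWPDDiscreteOrdered h hh) :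
    WWPDDiscreteOrdered h⁻¹ hh.inv := by
  obtain ⟨x, -⟩ := id hh
  obtain ⟨r, hr⟩ := (wwpdDiscreteOrdered_iff hh x).1 H
  refine (wwpdDiscreteOrdered_iff hh.inv x).2 ⟨r, fun g hg => ?_⟩
  rw [endPair_inv _ hh, smul_swap, BoundaryPair.swap_mem_nhd_iff] at hg
  rw [endPair_inv _ hh, smul_swap, hr g hg]

/-- If `g` fixes the attracting point of `h` and moves its repelling point, then for large `i` the
element `h⁻¹ ^ i * g` carries `∂_± h` close to itself without fixing it. -/
theorem WWPDDiscreteOrdered.smul_repellingPoint_eq {h : Γ} {hh : IsLoxodromic X h}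
    (H : WWPDDiscreteOrdered h hh) {g : Γ}
    (hg : g • attractingPoint h hh = attractingPoint h hh) :
    g • repellingPoint h hh = repellingPoint h hh := by
  obtain ⟨x, -⟩ := id hh
  obtain ⟨r, hr⟩ := (wwpdDiscreteOrdered_iff hh x).1 H
  have hne : g • repellingPoint h hh ≠ attractingPoint h hh := fun e =>
    repellingPoint_ne_attractingPoint h hh (MulAction.injective g (e.trans hg.symm))
  obtain ⟨i, hi⟩ := hh.exists_inv_pow_smul_mem_boundaryNhd x hne r
  have hrep : ∀ n : ℤ, h ^ n • repellingPoint h hh = repellingPoint h hh := fun n =>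
    congrArg (fun q : BoundaryPair X => q.1.1) (zpow_smul_endPair_self h hh n)
  have hatt : ∀ n : ℤ, h ^ n • attractingPoint h hh = attractingPoint h hh := fun n =>
    congrArg (fun q : BoundaryPair X => q.1.2) (zpow_smul_endPair_self h hh n)
  have e₁ : (h⁻¹ ^ i * g) • attractingPoint h hh = attractingPoint h hh := by
    rw [mul_smul, hg, ← zpow_natCast, inv_zpow', hatt]
  have e₂ : (h⁻¹ ^ i * g) • attractingPoint h hh ∈ boundaryNhd x (attractingPoint h hh) r := by
    rw [e₁]
    exact mem_boundaryNhd_self _ _ _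
  have h₁ := hr (h⁻¹ ^ i * g) ⟨by rwa [← mul_smul] at hi, e₂⟩
  have h₂ : (h⁻¹ ^ i * g) • repellingPoint h hh = repellingPoint h hh :=
    congrArg (fun q : BoundaryPair X => q.1.1) h₁
  rwa [mul_smul, ← zpow_natCast, inv_zpow', ← eq_inv_smul_iff, ← zpow_neg, neg_neg, hrep] at h₂

theorem WWPDDiscreteOrdered.smul_attractingPoint_eq {h : Γ} {hh : IsLoxodromic X h}
    (H : WWPDDiscreteOrdered h hh) {g : Γ}
    (hg : g • repellingPoint h hh = repellingPoint h hh) :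
    g • attractingPoint h hh = attractingPoint h hh := by
  have := H.inv.smul_repellingPoint_eq (g := g) hg
  rwa [repellingPoint_inv] at this

theorem mem_stabilizer_endPair_iff {h : Γ} {hh : IsLoxodromic X h} {g : Γ} :
    g ∈ MulAction.stabilizer Γ (endPair h hh) ↔ g • repellingPoint h hh = repellingPoint h hh ∧
      g • attractingPoint h hh = attractingPoint h hh := by
  have h₁ : g • endPair h hh = endPair h hh ↔
      (g • repellingPoint h hh, g • attractingPoint h hh) =
        (repellingPoint h hh, attractingPoint h hh) := Subtype.ext_iff
  rw [MulAction.mem_stabilizer_iff, h₁, Prod.mk_inj]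

/-- A loxodromic element that shares its attracting point with `h` also fixes the repelling point
of `h`, but it fixes no boundary points other than its own ends. -/
theorem WWPDDiscreteOrdered.endPair_eq_of_attractingPoint_eq {h : Γ} {hh : IsLoxodromic X h}
    (H : WWPDDiscreteOrdered h hh) {γ : Γ} {hγ : IsLoxodromic X γ}
    (e : attractingPoint γ hγ = attractingPoint h hh) : endPair γ hγ = endPair h hh := by
  obtain ⟨x, -⟩ := id hh
  have h₁ : γ • attractingPoint h hh = attractingPoint h hh := by
    rw [← e]
    exact (mem_stabilizer_endPair_iff.1 (smul_endPair_self γ hγ)).2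
  have h₂ := H.smul_repellingPoint_eq h₁
  have h₃ : ∀ i : ℕ, γ⁻¹ ^ i • repellingPoint h hh = repellingPoint h hh := fun i =>
    (MulAction.stabilizer Γ (repellingPoint h hh)).pow_mem
      ((MulAction.stabilizer Γ (repellingPoint h hh)).inv_mem h₂) i
  have h₄ : repellingPoint h hh = repellingPoint γ hγ := by
    refine eq_of_forall_mem_boundaryNhd (p := x) fun r => ?_
    obtain ⟨i, hi⟩ := hγ.exists_inv_pow_smul_mem_boundaryNhd x
      (e ▸ repellingPoint_ne_attractingPoint h hh) r
    rwa [h₃] at hi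
  exact Subtype.ext (Prod.ext h₄.symm e)

theorem WWPDDiscreteOrdered.endSet_eq_or_disjoint {h : Γ} {hh : IsLoxodromic X h}
    (H : WWPDDiscreteOrdered h hh) (γ : Γ) (hγ : IsLoxodromic X γ) :
    (endSet γ hγ).1 = (endSet h hh).1 ∨ Disjoint (endSet γ hγ).1 (endSet h hh).1 := by
  refine or_iff_not_imp_right.2 fun hdisj => ?_
  obtain ⟨ζ, hζγ, hζh⟩ := Set.not_disjoint_iff.1 hdisj
  refine congrArg Subtype.val (BoundaryPair.toTwoSet_eq_iff.2 ?_)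
  have hswap : ∀ {q q' : BoundaryPair X}, q.swap = q' → q = q'.swap := by
    rintro q _ rfl; rfl
  -- After `γ` or `h` is replaced by its inverse, the shared point is attracting for both.
  rcases hζγ with e₁ | e₁ <;> rcases hζh with e₂ | e₂
  · have := H.inv.endPair_eq_of_attractingPoint_eq (hγ := hγ.inv) (e₁.symm.trans e₂)
    rw [endPair_inv _ hγ, endPair_inv _ hh] at this
    exact Or.inl (hswap this)
  · have := H.endPair_eq_of_attractingPoint_eq (hγ := hγ.inv) (e₁.symm.trans e₂)
    rw [endPair_inv _ hγ] at this
    exact Or.inr (hswap this)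
  · have := H.inv.endPair_eq_of_attractingPoint_eq (hγ := hγ) (e₁.symm.trans e₂)
    rw [endPair_inv _ hh] at this
    exact Or.inr this
  · exact Or.inl (H.endPair_eq_of_attractingPoint_eq (e₁.symm.trans e₂))

omit [IsGromovHyperbolic X] in
theorem IsLoxodromic.conj {h : Γ} (hh : IsLoxodromic X h) (k : Γ) :
    IsLoxodromic X (k * h * k⁻¹) := by
  obtain ⟨x, K, c, hK, hc, H⟩ := hh
  refine ⟨k • x, K, c, hK, hc, fun s t => ?_⟩
  simpa only [conj_zpow, mul_smul, inv_smul_smul, dist_smul] using H s t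

theorem WWPDDiscreteOrdered.areIndependent_conj {h : Γ} {hh : IsLoxodromic X h}
    (H : WWPDDiscreteOrdered h hh) {k : Γ} (hk : k ∉ MulAction.stabilizer Γ (endSet h hh)) :
    AreIndependent X h (k * h * k⁻¹) := by
  refine ⟨hh, hh.conj k, ?_⟩
  rcases H.endSet_eq_or_disjoint _ (hh.conj k) with e | e
  · refine absurd ?_ hk
    rw [MulAction.mem_stabilizer_iff, smul_endSet, ← endPair_conj hh (hh.conj k)]
    exact Subtype.ext e
  · exact e.symm

end NorthSouth

end HyperbolicAction

theorem mainTheorem3 {Γ : Type*} [Group Γ] {X : Type*} [MetricSpace X] [IsGromovHyperbolic X]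
    (hX : IsGeodesicSpace X) [MulAction Γ X] [IsIsometricSMul Γ X]
    (h : Γ) (hh : IsLoxodromic X h) :
    List.TFAE [WWPDAcylindrical h hh, WWPDDiscreteUnordered h hh, WWPDDiscreteOrdered h hh,
      WWPDBoundedProjections h hh, WWPDNoBadSequenceForall h hh, WWPDNoBadSequenceExists h hh] ∧
    (IsWWPD X h →
      (MulAction.stabilizer Γ (repellingPoint h hh) = MulAction.stabilizer Γ (endPair h hh) ∧
        MulAction.stabilizer Γ (attractingPoint h hh) = MulAction.stabilizer Γ (endPair h hh)) ∧
      (∀ (γ : Γ) (hγ : IsLoxodromic X γ),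
        (endSet γ hγ).1 = (endSet h hh).1 ∨ Disjoint (endSet γ hγ).1 (endSet h hh).1) ∧
      (∀ k : Γ, k ∉ MulAction.stabilizer Γ (endSet h hh) →
        AreIndependent X h (k * h * k⁻¹))) := by
  constructor
  · tfae_have 1 → 6 := WWPDAcylindrical.noBadSequenceExists
    tfae_have 6 → 5 := WWPDNoBadSequenceExists.noBadSequenceForall
    tfae_have 5 → 1 := WWPDNoBadSequenceForall.acylindrical
    tfae_have 5 → 3 := WWPDNoBadSequenceForall.discreteOrdered
    tfae_have 3 → 2 := WWPDDiscreteOrdered.discreteUnordered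
    tfae_have 2 → 4 := WWPDDiscreteUnordered.boundedProjections
    tfae_have 4 → 5 := WWPDBoundedProjections.noBadSequenceForall hX
    tfae_finish
  · rintro ⟨_, -, -, H, -⟩
    refine ⟨⟨?_, ?_⟩, H.endSet_eq_or_disjoint, fun k hk => H.areIndependent_conj hk⟩
    · ext g
      rw [mem_stabilizer_endPair_iff, MulAction.mem_stabilizer_iff]
      exact ⟨fun hg => ⟨hg, H.smul_attractingPoint_eq hg⟩, fun hg => hg.1⟩
    · ext g
      rw [mem_stabilizer_endPair_iff, MulAction.mem_stabilizer_iff]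
      exact ⟨fun hg => ⟨H.smul_repellingPoint_eq hg, hg⟩, fun hg => hg.2⟩
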